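/- Let $k$ be a field of characteristic $p>2$; superspaces, modules and linear maps are over $k$, and $|x|\in\mathbb Z/2$ is the degree of a homogeneous element $x$. For Lie superalgebras in characteristic $3$ the identity $[y,[y,y]]=0$ for odd $y$ is part of the definition (for $p>3$ it follows from the super Jacobi identity). Let $\mathfrak g=\mathfrak g_{\bar 0}\oplus\mathfrak g_{\bar 1}$ be a restricted Lie superalgebra with $p$-map $x\mapsto x^{[p]}$ on $\mathfrak g_{\bar 0}$. Let $M$ be a strongly abelian restricted Lie superalgebra, i.e. $[M,M]=0$ and $m^{[p]}=0$ for all $m\in M_{\bar 0}$, and let $M$ also be a restricted $\mathfrak g$-module, i.e. a $\mathfrak g$-supermodule on which $x^{[p]}$ acts as the $p$-th power of the action of $x$, for all $x\in\mathfrak g_{\bar 0}$. For $n=1,2$ let $H^n(\mathfrak g,M)$ be the ordinary cohomology of $\mathfrak g$ formed with even Lie cochains: a $1$-cocycle is an even linear map $h:\mathfrak g\to M$ with $h([x,y])=x\cdot h(y)-(-1)^{|x||y|}y\cdot h(x)$, and the $1$-coboundaries are the maps $x\mapsto x\cdot m$ with $m\in M_{\bar 0}$; a $2$-cochain is an even bilinear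 map $f:\mathfrak g\times\mathfrak g\to M$ with $f(x,y)=-(-1)^{|x||y|}f(y,x)$; it is a $2$-cocycle if, for homogeneous $x,y,z$, $$x\cdot f(y,z)-(-1)^{|x||y|}y\cdot f(x,z)+(-1)^{(|x|+|y|)|z|}z\cdot f(x,y)-f([x,y],z)+(-1)^{|y||z|}f([x,z],y)-(-1)^{|x|(|y|+|z|)}f([y,z],x)=0$$ and, for odd $y$, $y\cdot f(y,y)=f([y,y],y)$ (a consequence of the former if $p>3$); and the $2$-coboundaries are the maps $(x,y)\mapsto x\cdot h(y)-(-1)^{|x||y|}y\cdot h(x)-h([x,y])$ with $h:\mathfrak g\to M$ even and linear. A restricted extension of $M$ by $\mathfrak g$ is an exact sequence $0\to M\to E\xrightarrow{\phi}\mathfrak g\to0$ of restricted Lie superalgebras and (even) homomorphisms compatible with the $p$-maps, which induces on $M$ the given $\mathfrak g$-module structure. Its class in $H^2(\mathfrak g,M)$ is the class of the cocycle $f(x,y)=[s(x),s(y)]-s([x,y])\in M$, where $s:\mathfrak g\to E$ is any even linear section of $\phi$. Let $H^2_0(\mathfrak g,M)\subseteq H^2(\mathfrak g,M)$ be the set of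 the classes of all restricted extensions. (It corresponds to the set of restricted extensions up to similarity, i.e. up to isomorphisms of Lie superalgebras, not necessarily compatible with the $p$-maps, that fix $M$ and commute with the projections to $\mathfrak g$.) For a $2$-cocycle $f$ and $x\in\mathfrak g_{\bar 0}$ put $$\Phi_{f,x}(y)=\sum_{i=0}^{p-1}x^{i}\cdot f\big(x,(\operatorname{ad}x)^{p-1-i}(y)\big)+f\big(y,x^{[p]}\big)\qquad(y\in\mathfrak g).$$ Let $S(\mathfrak g_{\bar 0},H^1(\mathfrak g,M))$ be the space of $p$-semilinear maps, i.e. additive maps $\sigma$ with $\sigma(cx)=c^p\sigma(x)$ for $c\in k$. **Proposition 4.4.** Each $\Phi_{f,x}$ is a $1$-cocycle, and $[f]\mapsto\big(x\mapsto[\Phi_{f,x}]\big)$ is a well-defined linear map $$\Phi:H^2(\mathfrak g,M)\to S(\mathfrak g_{\bar 0},H^1(\mathfrak g,M)).$$ Moreover $H^2_0(\mathfrak g,M)=\operatorname{Ker}\Phi$. -/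

import Mathlib

set_option maxSynthPendingDepth 3

namespace RestrictedSuper

open Polynomial

universe u v w

/-- A superspace: a vector space `V = V₀ ⊕ V₁` graded by `ℤ/2`. -/
class SuperSpace (k : Type w) (V : Type u) [Field k] [AddCommGroup V] [Module k V] where
  /-- the homogeneous components -/
  part : ZMod 2 → Submodule k V
  isCompl : IsCompl (part 0) (part 1)

/-- The component of degree `i` of a superspace `V`. -/
abbrev gr (k : Type w) (V : Type u) [Field k] [AddCommGroup V] [Module k V] [SuperSpace k V]
    (i : ZMod 2) : Submodule k V :=
  SuperSpace.part i

/-- The sign `(-1)^{ij}`. -/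
def superSign (i j : ZMod 2) : ℤ := (-1) ^ (i.val * j.val)

/-- A Lie superalgebra over a field of characteristic different from `2`. The axiom `bracket_cube`
follows from the super Jacobi identity except in characteristic `3`, where it is the usual
additional axiom. -/
class LieSuperalgebra (k : Type w) (g : Type u) [Field k] [AddCommGroup g] [Module k g]
    extends SuperSpace k g where
  /-- the bracket -/
  bracket : g →ₗ[k] g →ₗ[k] g
  bracket_mem : ∀ {i j : ZMod 2} {x y : g}, x ∈ part i → y ∈ part j →
    bracket x y ∈ part (i + j)
  bracket_skew : ∀ {i j : ZMod 2} {x y : g}, x ∈ part i → y ∈ part j →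
    bracket x y = -(superSign i j • bracket y x)
  bracket_jacobi : ∀ {i j l : ZMod 2} {x y z : g}, x ∈ part i → y ∈ part j → z ∈ part l →
    bracket x (bracket y z) = bracket (bracket x y) z + superSign i j • bracket y (bracket x z)
  bracket_cube : ∀ {y : g}, y ∈ part 1 → bracket y (bracket y y) = 0

section Restricted

variable (k : Type w) {g : Type u} [Field k] [AddCommGroup g] [Module k g] [LieSuperalgebra k g]

/-- The bracket of a Lie superalgebra. -/
abbrev br (x y : g) : g := LieSuperalgebra.bracket (k := k) x y

/-- The adjoint map `ad x = [x, ·]`. -/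
abbrev adj (x : g) : Module.End k g := LieSuperalgebra.bracket (k := k) x

/-- The element `s_i(x, y)`: `i • s_i(x, y)` is the coefficient of `λ^{i-1}` in
`(ad (λ x + y))^{p-1} (x)`, computed in the polynomials over `End g`. -/
noncomputable def jacobsonTerm (p i : ℕ) (x y : g) : g :=
  (i : k)⁻¹ • (((C (adj k x) * X + C (adj k y) : (Module.End k g)[X]) ^ (p - 1)).coeff (i - 1)) x

end Restricted

/-- A restricted structure on a Lie superalgebra `g`: a `p`-th power map on the even part. -/
class PMap (k : Type w) (p : ℕ) (g : Type u) [Field k] [AddCommGroup g] [Module k g]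
    [LieSuperalgebra k g] where
  /-- the map `x ↦ x^[p]` -/
  pmap : gr k g 0 → gr k g 0
  pmap_smul : ∀ (c : k) (x : gr k g 0), pmap (c • x) = c ^ p • pmap x
  bracket_pmap : ∀ (x : gr k g 0) (y : g), br k (pmap x : g) y = (adj k (x : g) ^ p) y
  pmap_add : ∀ x y : gr k g 0,
    (pmap (x + y) : g) = pmap x + pmap y + ∑ i ∈ Finset.Icc 1 (p - 1), jacobsonTerm k p i (x : g) y

/-- `x^[p]` as an element of `g`. -/
abbrev pow (k : Type w) (p : ℕ) {g : Type u} [Field k] [AddCommGroup g] [Module k g]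
    [LieSuperalgebra k g] [PMap k p g] (x : gr k g 0) : g :=
  (PMap.pmap (p := p) x : gr k g 0)

/-- A restricted Lie superalgebra is strongly abelian if its bracket and its `p`-map vanish. -/
structure IsStronglyAbelian (k : Type w) (p : ℕ) (M : Type v) [Field k] [AddCommGroup M]
    [Module k M] [LieSuperalgebra k M] [PMap k p M] : Prop where
  bracket_eq_zero : ∀ x y : M, br k x y = 0
  pow_eq_zero : ∀ x : gr k M 0, pow k p x = 0

/-- A module over a Lie superalgebra `g` on the superspace `M`. -/
class SuperModule (k : Type w) (g : Type u) (M : Type v) [Field k] [AddCommGroup g] [Module k g]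
    [LieSuperalgebra k g] [AddCommGroup M] [Module k M] [SuperSpace k M] where
  /-- the action of `g` -/
  act : g →ₗ[k] Module.End k M
  act_mem : ∀ {i j : ZMod 2} {x : g} {m : M}, x ∈ gr k g i → m ∈ gr k M j →
    act x m ∈ gr k M (i + j)
  act_bracket : ∀ {i j : ZMod 2} {x y : g}, x ∈ gr k g i → y ∈ gr k g j → ∀ m : M,
    act (br k x y) m = act x (act y m) - superSign i j • act y (act x m)

/-- A module over a restricted Lie superalgebra is restricted if `x^[p]` acts as the `p`-th power
of the action of `x`, for all even `x`. -/
def IsRestrictedModule (k : Type w) (p : ℕ) (g : Type u) (M : Type v) [Field k] [AddCommGroup g]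
    [Module k g] [LieSuperalgebra k g] [PMap k p g] [AddCommGroup M] [Module k M] [SuperSpace k M]
    [SuperModule k g M] : Prop :=
  ∀ x : gr k g 0, SuperModule.act (k := k) (M := M) (pow k p x) =
    SuperModule.act (k := k) (M := M) (x : g) ^ p

section Cohomology

variable (k : Type w) (g : Type u) (M : Type v) [Field k] [AddCommGroup g] [Module k g]
  [LieSuperalgebra k g] [AddCommGroup M] [Module k M] [SuperSpace k M] [SuperModule k g M]

variable {g M} in
/-- The action `x · m`. -/
abbrev op (x : g) (m : M) : M := SuperModule.act (k := k) x m

/-- The `1`-cochains: even linear maps `g → M`. -/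
def C1 : Submodule k (g →ₗ[k] M) where
  carrier := {h | ∀ i : ZMod 2, ∀ x ∈ gr k g i, h x ∈ gr k M i}
  zero_mem' := fun _ _ _ => Submodule.zero_mem _
  add_mem' := fun ha hb i x hx => Submodule.add_mem _ (ha i x hx) (hb i x hx)
  smul_mem' := fun c _ ha i x hx => Submodule.smul_mem _ c (ha i x hx)

/-- The `2`-cochains: even, super-alternating bilinear maps `g × g → M`. -/
def C2 : Submodule k (g →ₗ[k] g →ₗ[k] M) where
  carrier := {f | ∀ i j : ZMod 2, ∀ x ∈ gr k g i, ∀ y ∈ gr k g j,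
    f x y ∈ gr k M (i + j) ∧ f x y = -(superSign i j • f y x)}
  zero_mem' := fun i j x _ y _ => ⟨Submodule.zero_mem _, by simp⟩
  add_mem' := fun ha hb i j x hx y hy =>
    ⟨Submodule.add_mem _ (ha i j x hx y hy).1 (hb i j x hx y hy).1, by
      simp only [LinearMap.add_apply, smul_add, neg_add]
      rw [← (ha i j x hx y hy).2, ← (hb i j x hx y hy).2]⟩
  smul_mem' := fun c f ha i j x hx y hy =>
    ⟨Submodule.smul_mem _ c (ha i j x hx y hy).1, by
      simp only [LinearMap.smul_apply]
      rw [smul_comm, ← smul_neg, ← (ha i j x hx y hy).2]⟩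

/-- The `1`-cocycles. -/
def Z1 : Submodule k (g →ₗ[k] M) where
  carrier := {h | h ∈ C1 k g M ∧ ∀ i j : ZMod 2, ∀ x ∈ gr k g i, ∀ y ∈ gr k g j,
    op k x (h y) - superSign i j • op k y (h x) - h (br k x y) = 0}
  zero_mem' := ⟨Submodule.zero_mem _, fun i j x _ y _ => by simp⟩
  add_mem' := fun {a b} ha hb => ⟨Submodule.add_mem _ ha.1 hb.1, fun i j x hx y hy => by
    have h1 := ha.2 i j x hx y hy
    have h2 := hb.2 i j x hx y hy
    simp only [LinearMap.add_apply, map_add, smul_add]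
    calc _ = (op k x (a y) - superSign i j • op k y (a x) - a (br k x y)) +
        (op k x (b y) - superSign i j • op k y (b x) - b (br k x y)) := by abel
      _ = 0 := by rw [h1, h2, add_zero]⟩
  smul_mem' := fun c a ha => ⟨Submodule.smul_mem _ c ha.1, fun i j x hx y hy => by
    have h1 := ha.2 i j x hx y hy
    simp only [LinearMap.smul_apply, map_smul]
    rw [smul_comm (superSign i j) c, ← smul_sub, ← smul_sub, h1, smul_zero]⟩

/-- The `1`-coboundaries `x ↦ x · m` of the `0`-cochains, the even elements `m` of `M`. -/
def B1 : Submodule k (g →ₗ[k] M) where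
  carrier := {h | ∃ m ∈ gr k M 0, ∀ x : g, h x = op k x m}
  zero_mem' := ⟨0, Submodule.zero_mem _, fun x => by simp⟩
  add_mem' := by
    rintro a b ⟨m, hm, ha⟩ ⟨n, hn, hb⟩
    exact ⟨m + n, Submodule.add_mem _ hm hn, fun x => by simp [ha, hb]⟩
  smul_mem' := by
    rintro c a ⟨m, hm, ha⟩
    exact ⟨c • m, Submodule.smul_mem _ c hm, fun x => by simp [ha]⟩

variable {k g M} in
/-- The value at homogeneous elements `x, y, z` of degrees `i, j, l` of the coboundary of the
`2`-cochain `f`. -/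
def d2 (f : g →ₗ[k] g →ₗ[k] M) (i j l : ZMod 2) (x y z : g) : M :=
  op k x (f y z) - superSign i j • op k y (f x z) + superSign (i + j) l • op k z (f x y)
    - f (br k x y) z + superSign j l • f (br k x z) y - superSign i (j + l) • f (br k y z) x

/-- The `2`-cocycles. If `y` is odd, then `d2 f 1 1 1 y y y` is three times
`y · f (y, y) - f ([y, y], y)`, so that the last condition follows from the preceding one except
in characteristic `3`. There it is the evaluation of the coboundary at the divided cube of `y`, and
belongs to the condition `[y, [y, y]] = 0` in the definition of a Lie superalgebra. -/
def Z2 : Submodule k (g →ₗ[k] g →ₗ[k] M) where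
  carrier := {f | f ∈ C2 k g M ∧
    (∀ i j l : ZMod 2, ∀ x ∈ gr k g i, ∀ y ∈ gr k g j, ∀ z ∈ gr k g l, d2 f i j l x y z = 0) ∧
    ∀ y ∈ gr k g 1, op k y (f y y) - f (br k y y) y = 0}
  zero_mem' := ⟨Submodule.zero_mem _, fun i j l x _ y _ z _ => by simp [d2], fun y _ => by simp⟩
  add_mem' := fun {a b} ha hb => ⟨Submodule.add_mem _ ha.1 hb.1,
    fun i j l x hx y hy z hz => by
      have h : d2 (a + b) i j l x y z = d2 a i j l x y z + d2 b i j l x y z := by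
        simp only [d2, LinearMap.add_apply, map_add, smul_add]
        abel
      rw [h, ha.2.1 i j l x hx y hy z hz, hb.2.1 i j l x hx y hy z hz, add_zero],
    fun y hy => by
      have h1 := ha.2.2 y hy
      have h2 := hb.2.2 y hy
      simp only [LinearMap.add_apply, map_add]
      rw [add_sub_add_comm, h1, h2, add_zero]⟩
  smul_mem' := fun c a ha => ⟨Submodule.smul_mem _ c ha.1,
    fun i j l x hx y hy z hz => by
      have h : d2 (c • a) i j l x y z = c • d2 a i j l x y z := by
        simp only [d2, LinearMap.smul_apply, map_smul, smul_sub, smul_add]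
        simp only [smul_comm _ c]
      rw [h, ha.2.1 i j l x hx y hy z hz, smul_zero],
    fun y hy => by
      have h1 := ha.2.2 y hy
      simp only [LinearMap.smul_apply, map_smul]
      rw [← smul_sub, h1, smul_zero]⟩

/-- The `2`-coboundaries: the bilinear maps given on homogeneous elements by
`(x, y) ↦ x · h y - (-1)^{|x||y|} y · h x - h [x, y]` for a `1`-cochain `h`. -/
def B2 : Submodule k (g →ₗ[k] g →ₗ[k] M) where
  carrier := {f | ∃ h ∈ C1 k g M, ∀ i j : ZMod 2, ∀ x ∈ gr k g i, ∀ y ∈ gr k g j,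
    f x y = op k x (h y) - superSign i j • op k y (h x) - h (br k x y)}
  zero_mem' := ⟨0, Submodule.zero_mem _, fun i j x _ y _ => by simp⟩
  add_mem' := by
    rintro a b ⟨h, hh, ha⟩ ⟨h', hh', hb⟩
    refine ⟨h + h', Submodule.add_mem _ hh hh', fun i j x hx y hy => ?_⟩
    simp only [LinearMap.add_apply, map_add, smul_add]
    rw [ha i j x hx y hy, hb i j x hx y hy]
    abel
  smul_mem' := by
    rintro c a ⟨h, hh, ha⟩
    refine ⟨c • h, Submodule.smul_mem _ c hh, fun i j x hx y hy => ?_⟩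
    simp only [LinearMap.smul_apply, map_smul]
    rw [ha i j x hx y hy, smul_comm (superSign i j) c, ← smul_sub, ← smul_sub]

/-- The first cohomology `H¹(g, M)`. -/
abbrev H1 : Type (max u v) := Z1 k g M ⧸ (B1 k g M).comap (Z1 k g M).subtype

/-- The second cohomology `H²(g, M)`. -/
abbrev H2 : Type (max u v) := Z2 k g M ⧸ (B2 k g M).comap (Z2 k g M).subtype

variable {k g M}

/-- The class in `H¹(g, M)` of a `1`-cocycle. -/
abbrev H1.mk (h : Z1 k g M) : H1 k g M := Submodule.Quotient.mk h

/-- The class in `H²(g, M)` of a `2`-cocycle. -/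
abbrev H2.mk (f : Z2 k g M) : H2 k g M := Submodule.Quotient.mk f

/-- The map `k_x + f_{x^[p]}`, that is
`y ↦ ∑_{i < p} xⁱ · f (x, (ad x)^{p-1-i} y) + f (y, x^[p])`. -/
noncomputable def phiCochain (p : ℕ) [PMap k p g] (f : g →ₗ[k] g →ₗ[k] M) (x : gr k g 0) :
    g →ₗ[k] M :=
  ∑ i ∈ Finset.range p,
    (SuperModule.act (k := k) (M := M) (x : g) ^ i) ∘ₗ f (x : g) ∘ₗ (adj k (x : g) ^ (p - 1 - i))
  + f.flip (pow k p x)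

end Cohomology

section Extensions

/-- An extension `0 → M → E → g → 0` of Lie superalgebras that induces on `M` the given structure
of a `g`-module. -/
structure Extension (k : Type w) (g : Type u) (M : Type v) (E : Type (max u v)) [Field k]
    [AddCommGroup g] [Module k g] [LieSuperalgebra k g]
    [AddCommGroup M] [Module k M] [LieSuperalgebra k M] [SuperModule k g M]
    [AddCommGroup E] [Module k E] [LieSuperalgebra k E] where
  /-- the inclusion of `M` -/
  incl : M →ₗ[k] E
  /-- the projection to `g` -/
  proj : E →ₗ[k] g
  incl_mem : ∀ {i : ZMod 2} {m : M}, m ∈ gr k M i → incl m ∈ gr k E i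
  proj_mem : ∀ {i : ZMod 2} {e : E}, e ∈ gr k E i → proj e ∈ gr k g i
  incl_bracket : ∀ m n : M, incl (br k m n) = br k (incl m) (incl n)
  proj_bracket : ∀ e e' : E, proj (br k e e') = br k (proj e) (proj e')
  incl_injective : Function.Injective incl
  proj_surjective : Function.Surjective proj
  exact : LinearMap.range incl = LinearMap.ker proj
  bracket_incl : ∀ (e : E) (m : M), br k e (incl m) = incl (op k (proj e) m)

variable {k : Type w} {g : Type u} {M : Type v} {E : Type (max u v)} [Field k]
  [AddCommGroup g] [Module k g] [LieSuperalgebra k g]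
  [AddCommGroup M] [Module k M] [LieSuperalgebra k M] [SuperModule k g M]
  [AddCommGroup E] [Module k E] [LieSuperalgebra k E]

/-- The extension is restricted for the given `p`-maps: the inclusion and the projection are
compatible with them. -/
structure Extension.IsRestricted (p : ℕ) [PMap k p g] [PMap k p M] [PMap k p E]
    (X : Extension k g M E) : Prop where
  incl_pow : ∀ m : gr k M 0,
    X.incl (pow k p m) = pow k p (⟨X.incl m, X.incl_mem m.2⟩ : gr k E 0)
  proj_pow : ∀ e : gr k E 0,
    X.proj (pow k p e) = pow k p (⟨X.proj e, X.proj_mem e.2⟩ : gr k g 0)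

/-- `c ∈ H²(g, M)` is the class of the extension: it is the class of the cocycle
`(x, y) ↦ [s x, s y] - s [x, y]` of an even linear section `s` of the projection. -/
def Extension.HasClass (X : Extension k g M E) (c : H2 k g M) : Prop :=
  ∃ (s : g →ₗ[k] E) (f : Z2 k g M),
    (∀ i : ZMod 2, ∀ x ∈ gr k g i, s x ∈ gr k E i) ∧ (∀ x : g, X.proj (s x) = x) ∧
    (∀ x y : g, X.incl (f.1 x y) = br k (s x) (s y) - s (br k x y)) ∧ c = H2.mk f

variable (k g M)

/-- The subset `H²₀(g, M)` of `H²(g, M)`: the classes of the restricted extensions of `M` by `g`.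
(Every extension is isomorphic, as a superspace, to `g × M`, so the universe of `E` is no
restriction.) -/
def H20 (p : ℕ) [PMap k p g] [PMap k p M] : Set (H2 k g M) :=
  {c | ∃ (E : Type (max u v)) (_ : AddCommGroup E) (_ : Module k E) (_ : LieSuperalgebra k E)
    (_ : PMap k p E) (X : Extension k g M E), X.IsRestricted p ∧ X.HasClass c}

end Extensions

end RestrictedSuper

/-!
Let `0 → M → E → g → 0` be an extension with an even section `s` and cocycle `f`. The point of
`Φ_{f,x}` is that it compares two derivations of `E`: the inclusion of `M` carries `Φ_{f,x}(y)` to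
`((ad s(x))^p - ad s(x^[p])) (s y)` (`Extension.IsSection.incl_phiCochain`). Both `(ad s(x))^p` and
`ad s(x^[p])` are derivations, and they agree on `M` because `M` is a restricted module; hence
`Φ_{f,x}` is a `1`-cocycle. Since every cocycle comes from an extension on `g × M`
(`exists_extension_of_mem_Z2`), all statements about `Φ_{f,x}` can be read off in extensions.
Jacobson's formula `(a + b)^p = a^p + b^p + s(a, b)` in `End E` shows that `Φ_{f,x}` is additive in
`x` up to inner derivations `ad m`, with `m` in `M`, that is, up to coboundaries. In the same way
a change of the section changes `Φ_{f,x}` by a coboundary, so that `Φ` vanishes on the coboundaries,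
which are the cocycles of the sections of the split extension.

If `E` is restricted, then `Φ_{f,x}` is the coboundary of an element of `M`, up to sign
`s(x)^[p] - s(x^[p])`. Conversely, suppose that all `Φ_{f,x}` are coboundaries. Then every even
element `e` of `E` has an element `a` over the `p`-th power of its image with `ad a = (ad e)^p`,
and it has to be shown that the elements `a` can be chosen so as to form a `p`-map
(`IsLieBracket.exists_pmap`). The pairs `(e, a)` form a vector space under the addition twisted by
the Jacobson sum `s(x, y)` and the scalar action `c (e, a) = (c e, c^p a)`, and a linear section of
its projection to `e` is a `p`-map; one that vanishes on `M` is then obtained by subtracting a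
semilinear map.

The vector space axioms amount to `s(x, y) = s(y, x)` and
`s(x, y) + s(x + y, z) = s(y, z) + s(x, y + z)` in a Lie algebra `L` of characteristic `p`. These
are clear for commutators in an associative algebra, but `L` has no obvious faithful
representation on which to use Jacobson's formula. Instead, one variable is multiplied by an
indeterminate `t`. The Lie algebra `L[t]` acts on `L[t] ⊕ k d`, where `d = t d/dt`, and an element
that acts trivially is killed by `d`; if its degree is less than `p`, then it is constant
(`evalAt_one_eq_evalAt_zero`). Therefore the difference of the two sides has the same value at
`t = 1` and at `t = 0`, where it vanishes.
-/

set_option maxSynthPendingDepth 3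

namespace RestrictedSuper

open Polynomial

universe u v w

/-! ### The Jacobson sum of a bilinear product -/

section JacobsonSum

variable {k V W : Type*} [Field k] [AddCommGroup V] [Module k V] [AddCommGroup W] [Module k W]

/-- The coefficient of `λ^i` in `(β (λ x + y))^n`, as an endomorphism of `V`, for a bilinear
product `β` on `V`. -/
noncomputable def adCoeff (β : V →ₗ[k] V →ₗ[k] V) (x y : V) (n i : ℕ) : Module.End k V :=
  ((C (β x) * X + C (β y) : (Module.End k V)[X]) ^ n).coeff i

/-- Jacobson's correction term `s(x, y) = ∑ sᵢ(x, y)`, which measures the failure of additivity of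
a `p`-map, for an arbitrary bilinear product `β`. -/
noncomputable def jacobsonSum (β : V →ₗ[k] V →ₗ[k] V) (p : ℕ) (x y : V) : V :=
  ∑ i ∈ Finset.Icc 1 (p - 1), (i : k)⁻¹ • adCoeff β x y (p - 1) (i - 1) x

variable (β : V →ₗ[k] V →ₗ[k] V) (x y : V)

lemma adCoeff_zero (i : ℕ) : adCoeff β x y 0 i = if i = 0 then 1 else 0 := by
  simp only [adCoeff, pow_zero, coeff_one]

lemma adCoeff_succ_zero (n : ℕ) : adCoeff β x y (n + 1) 0 = β y * adCoeff β x y n 0 := by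
  simp [adCoeff, pow_succ', add_mul, mul_assoc, mul_coeff_zero]

lemma adCoeff_succ_succ (n i : ℕ) :
    adCoeff β x y (n + 1) (i + 1) = β x * adCoeff β x y n i + β y * adCoeff β x y n (i + 1) := by
  simp [adCoeff, pow_succ', add_mul, mul_assoc, coeff_C_mul, coeff_X_mul]

lemma adCoeff_succ_self (hx : β x x = 0) (n i : ℕ) :
    adCoeff β x y (n + 1) i x = adCoeff β x y n i (β y x) := by
  have h : ∀ Q : (Module.End k V)[X],
      ((Q * (C (β x) * X + C (β y))).coeff i) x = Q.coeff i (β y x) := by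
    intro Q
    rw [mul_add, ← mul_assoc]
    cases i with
    | zero => simp [mul_coeff_zero]
    | succ i => simp [coeff_mul_X, coeff_mul_C, hx]
  rw [adCoeff, pow_succ, h]
  rfl

variable {β} in
lemma map_adCoeff {γ : W →ₗ[k] W →ₗ[k] W} (φ : V →ₗ[k] W)
    (h : ∀ u v, φ (β u v) = γ (φ u) (φ v)) (n i : ℕ) (v : V) :
    φ (adCoeff β x y n i v) = adCoeff γ (φ x) (φ y) n i (φ v) := by
  induction n generalizing i with
  | zero =>
    simp only [adCoeff_zero]
    split_ifs <;> simp
  | succ n ih =>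
    cases i with
    | zero => simp [adCoeff_succ_zero, h, ih]
    | succ i => simp [adCoeff_succ_succ, h, ih]

variable {β} in
lemma map_jacobsonSum {γ : W →ₗ[k] W →ₗ[k] W} (φ : V →ₗ[k] W)
    (h : ∀ u v, φ (β u v) = γ (φ u) (φ v)) (p : ℕ) :
    φ (jacobsonSum β p x y) = jacobsonSum γ p (φ x) (φ y) := by
  simp only [jacobsonSum, map_sum, map_smul, map_adCoeff x y φ h]

/-- The correction term vanishes on commuting elements. -/
lemma jacobsonSum_eq_zero {p : ℕ} (hp : 2 ≤ p) (hx : β x x = 0) (h : β y x = 0) :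
    jacobsonSum β p x y = 0 := by
  obtain ⟨q, rfl⟩ := Nat.exists_eq_add_of_le hp
  refine Finset.sum_eq_zero fun i _ => ?_
  rw [show 2 + q - 1 = q + 1 by omega, adCoeff_succ_self β x y hx, h, map_zero, smul_zero]

lemma jacobsonSum_smul (c : k) {p : ℕ} (hp : 1 ≤ p) :
    jacobsonSum β p (c • x) (c • y) = c ^ p • jacobsonSum β p x y := by
  have h : ∀ n i, adCoeff β (c • x) (c • y) n i = c ^ n • adCoeff β x y n i := by
    intro n
    induction n with
    | zero => intro i; simp [adCoeff_zero]
    | succ n ih =>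
      intro i
      cases i with
      | zero => simp [adCoeff_succ_zero, ih, smul_smul, pow_succ]
      | succ i => simp [adCoeff_succ_succ, ih, smul_smul, pow_succ]
  obtain ⟨q, rfl⟩ := Nat.exists_eq_add_of_le' hp
  simp only [jacobsonSum, Finset.smul_sum]
  refine Finset.sum_congr rfl fun i _ => ?_
  rw [h, map_smul, LinearMap.smul_apply, smul_smul, smul_comm, smul_smul, smul_smul,
    Nat.add_sub_cancel, pow_succ']
  congr 1
  ring

variable {β x y} in
lemma adCoeff_mem_filtration {D : ℕ → Submodule k V}
    (hx : ∀ n, ∀ v ∈ D n, β x v ∈ D (n + 1)) (hy : ∀ n, ∀ v ∈ D n, β y v ∈ D (n + 1))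
    {m : ℕ} {v : V} (hv : v ∈ D m) (n i : ℕ) : adCoeff β x y n i v ∈ D (m + n) := by
  induction n generalizing i with
  | zero =>
    rw [adCoeff_zero]
    split_ifs
    exacts [hv, Submodule.zero_mem _]
  | succ n ih =>
    rw [← add_assoc]
    cases i with
    | zero => simpa [adCoeff_succ_zero] using hy _ _ (ih 0)
    | succ i =>
      simpa [adCoeff_succ_succ] using Submodule.add_mem _ (hx _ _ (ih i)) (hy _ _ (ih (i + 1)))

variable {β x y} in
/-- If `β x` and `β y` raise the filtration degree by one, then `s(x, y)` lies in degree `p - 1`,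
one less than its `p` factors suggest, as soon as `β y x` has degree one. -/
lemma jacobsonSum_mem_filtration {D : ℕ → Submodule k V}
    (hx : ∀ n, ∀ v ∈ D n, β x v ∈ D (n + 1)) (hy : ∀ n, ∀ v ∈ D n, β y v ∈ D (n + 1))
    (hxx : β x x = 0) (hyx : β y x ∈ D 1) {p : ℕ} (hp : 2 ≤ p) :
    jacobsonSum β p x y ∈ D (p - 1) := by
  obtain ⟨q, rfl⟩ := Nat.exists_eq_add_of_le hp
  refine Submodule.sum_mem _ fun i _ => Submodule.smul_mem _ _ ?_
  rw [show 2 + q - 1 = q + 1 by omega, adCoeff_succ_self β x y hxx, add_comm q]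
  exact adCoeff_mem_filtration hx hy hyx _ _

end JacobsonSum

/-! ### Jacobson's formula in associative algebras -/

section Associative

variable {k A : Type*} [Field k] [Ring A] [Algebra k A]

variable (k A) in
/-- The commutator of an associative algebra, as a bilinear map. -/
noncomputable def commutator : A →ₗ[k] A →ₗ[k] A :=
  LinearMap.mul k A - (LinearMap.mul k A).flip

@[simp]
lemma commutator_apply (a b : A) : commutator k A a b = a * b - b * a := rfl

/-- The congruence `(p - 1).choose m ≡ (-1)^m` modulo `p`. -/
lemma neg_one_pow_mul_choose_pred {R : Type*} [CommRing R] (p : ℕ) [hp : Fact p.Prime] [CharP R p]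
    {m : ℕ} (hm : m ≤ p - 1) : (-1 : R) ^ m * ((p - 1).choose m : R) = 1 := by
  induction m with
  | zero => simp
  | succ m ih =>
    have h0 : ((p.choose (m + 1) : ℕ) : R) = 0 :=
      (CharP.cast_eq_zero_iff R p _).2
        (hp.out.dvd_choose_self (by omega) (by have := hp.out.two_le; omega))
    have h1 : p.choose (m + 1) = (p - 1).choose m + (p - 1).choose (m + 1) := by
      conv_lhs => rw [show p = p - 1 + 1 by have := hp.out.two_le; omega]
      rw [Nat.choose_succ_succ]
    rw [h1, Nat.cast_add] at h0
    rw [pow_succ]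
    linear_combination ih (by omega) - (-1 : R) ^ m * h0

lemma neg_one_pow_pred (R : Type*) [CommRing R] (p : ℕ) [hp : Fact p.Prime] [CharP R p] :
    (-1 : R) ^ (p - 1) = 1 := by
  simpa using neg_one_pow_mul_choose_pred (R := R) p le_rfl

variable (k) in
/-- In characteristic `p`, `(a - b)^{p-1} = (a^p - b^p) / (a - b)` for commuting `a` and `b`. -/
lemma sub_pow_pred_of_commute (p : ℕ) [hp : Fact p.Prime] [CharP k p] {a b : A}
    (h : Commute a b) :
    (a - b) ^ (p - 1) = ∑ m ∈ Finset.range p, a ^ m * b ^ (p - 1 - m) := by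
  have hp1 : p - 1 + 1 = p := Nat.sub_add_cancel hp.out.one_le
  rw [sub_eq_add_neg, (h.neg_right).add_pow, hp1]
  refine Finset.sum_congr rfl fun m hm => ?_
  have hm' : m ≤ p - 1 := by have := Finset.mem_range.1 hm; omega
  have key : (-1 : k) ^ (p - 1 - m) * ((p - 1).choose m : k) = 1 := by
    rw [← Nat.choose_symm hm']
    exact neg_one_pow_mul_choose_pred p (Nat.sub_le _ _)
  have key' := congrArg (algebraMap k A) key
  simp only [map_mul, map_pow, map_neg, map_one, map_natCast] at key'
  rw [neg_pow b, mul_assoc, ← (Nat.cast_commute _ _).eq, ← mul_assoc ((p - 1).choose m : A),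
    (Nat.cast_commute _ _).eq, key', one_mul]

variable (k) in
lemma sub_pow_prime_of_commute (p : ℕ) [hp : Fact p.Prime] [CharP k p] {a b : A}
    (h : Commute a b) : (a - b) ^ p = a ^ p - b ^ p := by
  rcases subsingleton_or_nontrivial A with _ | _
  · exact Subsingleton.elim _ _
  · have := charP_of_injective_algebraMap (algebraMap k A).injective p
    exact sub_pow_char_of_commute p h

lemma derivative_linear_pow (a b : A) (n : ℕ) :
    derivative ((C a * X + C b : A[X]) ^ n) =
      ∑ j ∈ Finset.range n, (C a * X + C b) ^ j * C a * (C a * X + C b) ^ (n - 1 - j) := by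
  induction n with
  | zero => simp
  | succ n ih =>
    rw [pow_succ', derivative_mul, ih, Finset.sum_range_succ', Finset.mul_sum, add_comm]
    congr 1
    · refine Finset.sum_congr rfl fun j _ => ?_
      rw [pow_succ', ← mul_assoc, ← mul_assoc]
      congr 2
      omega
    · simp

/-- The coefficients of `(ad (λ a + b))^n v`, computed in `A[λ]`, are given by `adCoeff`. -/
lemma coeff_commutator_pow (a b v : A) (n i : ℕ) :
    ((commutator k A[X] (C a * X + C b) ^ n) (C v)).coeff i
      = adCoeff (commutator k A) a b n i v := by
  induction n generalizing i with
  | zero =>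
    rw [adCoeff_zero, pow_zero, Module.End.one_apply, coeff_C]
    split_ifs <;> simp
  | succ n ih =>
    rw [pow_succ', Module.End.mul_apply, commutator_apply]
    generalize hQ : ((commutator k A[X] (C a * X + C b)) ^ n) (C v) = Q at ih
    cases i with
    | zero =>
      simp [adCoeff_succ_zero, ← ih, add_mul, mul_add, mul_coeff_zero]
    | succ i =>
      have e1 : (C a * X * Q).coeff (i + 1) = a * Q.coeff i := by
        rw [mul_assoc, coeff_C_mul, coeff_X_mul]
      have e2 : (Q * (C a * X)).coeff (i + 1) = Q.coeff i * a := by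
        rw [← mul_assoc, coeff_mul_X, coeff_mul_C]
      simp only [adCoeff_succ_succ, LinearMap.add_apply, Module.End.mul_apply, ← ih,
        commutator_apply, add_mul, mul_add, coeff_sub, coeff_add, e1, e2, coeff_C_mul, coeff_mul_C]
      abel

/-- Jacobson's formula, obtained from the derivative of `(λ a + b)^p` with respect to `λ`. -/
theorem add_pow_prime_eq (p : ℕ) [hp : Fact p.Prime] [CharP k p] (a b : A) :
    (a + b) ^ p = a ^ p + b ^ p + jacobsonSum (commutator k A) p a b := by
  set P : A[X] := C a * X + C b with hP
  have hp1 : p - 1 + 1 = p := Nat.sub_add_cancel hp.out.one_le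
  -- the derivative of `P^p` is `∑ P^m a P^(p-1-m)`, and `∑ L^m R^(p-1-m) = (L - R)^(p-1)` for the
  -- commuting left and right multiplications `L` and `R` by `P`
  have hder : derivative (P ^ p) = (commutator k A[X] P ^ (p - 1)) (C a) := by
    have h1 : commutator k A[X] P = LinearMap.mulLeft k P - LinearMap.mulRight k P := rfl
    rw [hP, derivative_linear_pow, ← hP, h1,
      sub_pow_pred_of_commute k p (LinearMap.commute_mulLeft_right P P), LinearMap.sum_apply]
    refine Finset.sum_congr rfl fun m _ => ?_
    rw [LinearMap.pow_mulLeft, LinearMap.pow_mulRight]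
    simp [mul_assoc]
  have hcoeff : ∀ i ∈ Finset.Icc 1 (p - 1), (P ^ p).coeff i =
      (i : k)⁻¹ • adCoeff (commutator k A) a b (p - 1) (i - 1) a := by
    intro i hi
    obtain ⟨hi1, hi2⟩ := Finset.mem_Icc.1 hi
    obtain ⟨j, rfl⟩ := Nat.exists_eq_add_of_le' hi1
    have hne : ((j + 1 : ℕ) : k) ≠ 0 := by
      rw [Ne, CharP.cast_eq_zero_iff k p]
      exact fun h => absurd (Nat.le_of_dvd (by omega) h) (by omega)
    rw [← coeff_commutator_pow, ← hP, ← hder, Nat.add_sub_cancel, coeff_derivative, eq_comm,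
      inv_smul_eq_iff₀ hne, Algebra.smul_def, map_natCast, (Nat.cast_commute _ _).eq]
    push_cast
    rfl
  have hdeg : P.natDegree ≤ 1 := by
    rw [hP]
    exact natDegree_linear_le
  have hdeg' : (P ^ p).natDegree < p + 1 := by
    have := natDegree_pow_le_of_le p hdeg
    omega
  have hP1 : P.coeff 1 = a := by simp [hP]
  have hP0 : P.coeff 0 = b := by simp [hP]
  have htop : (P ^ p).coeff p = a ^ p := by
    have := coeff_pow_of_natDegree_le (m := p) hdeg
    rwa [mul_one, hP1] at this
  have hbot : (P ^ p).coeff 0 = b ^ p := by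
    rw [← constantCoeff_apply, map_pow, constantCoeff_apply, hP0]
  -- evaluation at `1` is multiplicative although `A` is not commutative, since `1` is central
  let ev : A[X] →+* A := eval₂RingHom' (RingHom.id A) 1 fun _ => Commute.one_right _
  have hev : ev P = a + b := by simp [ev, eval₂RingHom', hP]
  have hev' : ∀ Q : A[X], ev Q = Q.eval 1 := fun Q => rfl
  rw [← hev, ← map_pow, hev', eval_eq_sum_range' hdeg', Finset.sum_range_succ, jacobsonSum,
    ← Finset.sum_congr rfl hcoeff, htop]
  simp only [one_pow, mul_one]
  conv_lhs => rw [← hp1, Finset.sum_range_succ', hp1, hbot]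
  rw [show (Finset.Icc 1 (p - 1)).sum (P ^ p).coeff =
      ∑ i ∈ Finset.range (p - 1), (P ^ p).coeff (i + 1) from
    Finset.sum_nbij' (fun i => i - 1) (fun i => i + 1) (by simp; omega) (by simp)
      (by simp; omega) (by simp) (fun i hi => by
        rw [Nat.sub_add_cancel (Finset.mem_Icc.1 hi).1])]
  abel

variable {V : Type*} [AddCommGroup V] [Module k V]

/-- Jacobson's formula for a representation of a Lie algebra in an associative algebra. -/
lemma map_jacobsonSum_eq (p : ℕ) [hp : Fact p.Prime] [CharP k p] {β : V →ₗ[k] V →ₗ[k] V}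
    (ρ : V →ₗ[k] A) (hρ : ∀ u v, ρ (β u v) = ρ u * ρ v - ρ v * ρ u) (x y : V) :
    ρ (jacobsonSum β p x y) = (ρ x + ρ y) ^ p - ρ x ^ p - ρ y ^ p := by
  rw [map_jacobsonSum x y ρ (γ := commutator k A) hρ, add_pow_prime_eq (k := k)]
  abel

end Associative

/-! ### The Jacobson sum of a Lie algebra is a symmetric cocycle -/

section Loop

variable {k L : Type*} [Field k] [AddCommGroup L] [Module k L]

/-- The bilinear product `β` is a Lie bracket: it is alternating and satisfies the Jacobi identity,
which is written as the derivation property of `β x`. -/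
structure IsLieBracket (β : L →ₗ[k] L →ₗ[k] L) : Prop where
  self : ∀ x, β x x = 0
  jacobi : ∀ x y z, β x (β y z) = β (β x y) z + β y (β x z)

lemma IsLieBracket.skew {β : L →ₗ[k] L →ₗ[k] L} (hβ : IsLieBracket β) (x y : L) :
    β x y = -β y x := by
  have h := hβ.self (x + y)
  simp only [map_add, LinearMap.add_apply, hβ.self, zero_add, add_zero] at h
  exact eq_neg_of_add_eq_zero_right h

/-- The product of the polynomials `L[t]` over `L`, realized as the finitely supported sequences
in `L`. -/
noncomputable def loop (β : L →ₗ[k] L →ₗ[k] L) : (ℕ →₀ L) →ₗ[k] (ℕ →₀ L) →ₗ[k] (ℕ →₀ L) :=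
  Finsupp.lsum k fun i => LinearMap.flip
    (Finsupp.lsum k fun j => (β.compr₂ (Finsupp.lsingle (i + j))).flip)

/-- The derivation `t d/dt` of `L[t]`. -/
noncomputable def euler (k L : Type*) [Field k] [AddCommGroup L] [Module k L] :
    (ℕ →₀ L) →ₗ[k] (ℕ →₀ L) :=
  Finsupp.lsum k fun i => (i : k) • Finsupp.lsingle i

/-- The evaluation `L[t] → L` at `t = c`. -/
noncomputable def evalAt (L : Type*) {k : Type*} [Field k] [AddCommGroup L] [Module k L] (c : k) :
    (ℕ →₀ L) →ₗ[k] L :=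
  Finsupp.lsum k fun i => c ^ i • LinearMap.id

@[simp]
lemma loop_single (β : L →ₗ[k] L →ₗ[k] L) (i j : ℕ) (v w : L) :
    loop β (Finsupp.single i v) (Finsupp.single j w) = Finsupp.single (i + j) (β v w) := by
  simp [loop]

@[simp]
lemma euler_single (i : ℕ) (v : L) :
    euler k L (Finsupp.single i v) = (i : k) • Finsupp.single i v := by
  simp [euler]

@[simp]
lemma evalAt_single (c : k) (i : ℕ) (v : L) : evalAt L c (Finsupp.single i v) = c ^ i • v := by
  simp [evalAt]

lemma euler_apply (u : ℕ →₀ L) (i : ℕ) : euler k L u i = (i : k) • u i := by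
  induction u using Finsupp.induction_linear with
  | zero => simp
  | add u v hu hv => simp [hu, hv]
  | single j v =>
    by_cases h : j = i
    · subst h; simp
    · simp [h]

variable {β : L →ₗ[k] L →ₗ[k] L}

lemma evalAt_loop (c : k) (u v : ℕ →₀ L) :
    evalAt L c (loop β u v) = β (evalAt L c u) (evalAt L c v) := by
  induction u using Finsupp.induction_linear with
  | zero => simp
  | add u u' hu hu' => simp [hu, hu']
  | single i x =>
    induction v using Finsupp.induction_linear with
    | zero => simp
    | add v v' hv hv' => simp [hv, hv']
    | single j y => simp [smul_smul, pow_add, mul_comm]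

/-- The adjoint action of `L[t]` on its extension `L[t] ⊕ k d` by the derivation `d = t d/dt`,
where `[u, d] = -d(u)`. -/
noncomputable def loopRep (β : L →ₗ[k] L →ₗ[k] L) :
    (ℕ →₀ L) →ₗ[k] Module.End k ((ℕ →₀ L) × k) :=
  LinearMap.mk₂ k (fun u w => (loop β u w.1 - w.2 • euler k L u, 0))
    (fun u u' w => by ext1 <;> simp; abel)
    (fun c u w => by ext1 <;> simp [smul_sub, smul_comm c])
    (fun u w w' => by ext1 <;> simp [add_smul]; abel)
    (fun c u w => by ext1 <;> simp [smul_sub, smul_smul])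

lemma loopRep_apply (u : ℕ →₀ L) (w : (ℕ →₀ L) × k) :
    loopRep β u w = (loop β u w.1 - w.2 • euler k L u, 0) := rfl

lemma euler_loop (hβ : IsLieBracket β) (u v : ℕ →₀ L) :
    euler k L (loop β u v) = loop β u (euler k L v) - loop β v (euler k L u) := by
  induction u using Finsupp.induction_linear with
  | zero => simp
  | add u u' hu hu' => simp [hu, hu']; abel
  | single i x =>
    induction v using Finsupp.induction_linear with
    | zero => simp
    | add v v' hv hv' => simp [hv, hv']; abel
    | single j y =>
      simp only [loop_single, euler_single, map_smul, hβ.skew y x, add_comm j i, Nat.cast_add,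
        add_smul, Finsupp.single_neg, smul_neg]
      abel

lemma loop_jacobi (hβ : IsLieBracket β) (u v w : ℕ →₀ L) :
    loop β u (loop β v w) = loop β (loop β u v) w + loop β v (loop β u w) := by
  induction u using Finsupp.induction_linear with
  | zero => simp
  | add u u' hu hu' => simp [hu, hu']; abel
  | single i x =>
    induction v using Finsupp.induction_linear with
    | zero => simp
    | add v v' hv hv' => simp [hv, hv']; abel
    | single j y =>
      induction w using Finsupp.induction_linear with
      | zero => simp
      | add w w' hw hw' => simp [hw, hw']; abel
      | single l z =>
        simp only [loop_single, hβ.jacobi x y z, Finsupp.single_add]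
        rw [add_assoc, add_left_comm j i l]

lemma loopRep_loop (hβ : IsLieBracket β) (u v : ℕ →₀ L) :
    loopRep β (loop β u v) = loopRep β u * loopRep β v - loopRep β v * loopRep β u := by
  refine LinearMap.ext fun w => ?_
  simp only [LinearMap.sub_apply, Module.End.mul_apply, loopRep_apply, euler_loop hβ]
  ext1
  · simp only [map_sub, map_smul, zero_smul, Prod.fst_sub, smul_sub, loop_jacobi hβ u v w.1]
    abel
  · simp

/-- A polynomial of degree less than `p` that acts trivially under `loopRep` is killed by
`t d/dt`, hence constant in characteristic `p`. -/
lemma evalAt_one_eq_evalAt_zero (p : ℕ) [CharP k p] {u : ℕ →₀ L} (hu : loopRep β u = 0)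
    (hdeg : u ∈ Finsupp.supported L k (Set.Iic (p - 1))) :
    evalAt L (1 : k) u = evalAt L (0 : k) u := by
  have he : euler k L u = 0 := by
    have h := congrArg Prod.fst (LinearMap.congr_fun hu (0, -1))
    simpa [loopRep_apply] using h
  have h0 : u = Finsupp.single 0 (u 0) := by
    ext i
    rcases Nat.eq_zero_or_pos i with rfl | hi
    · simp
    rw [Finsupp.single_eq_of_ne (by omega)]
    by_contra hne
    have hip : i ≤ p - 1 := hdeg (Finsupp.mem_support_iff.2 hne)
    have h := euler_apply (k := k) u i
    rw [he, Finsupp.zero_apply, eq_comm, smul_eq_zero, or_iff_left hne,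
      CharP.cast_eq_zero_iff k p] at h
    have := Nat.le_of_dvd hi h
    omega
  rw [h0]
  simp

lemma loop_mem_supported {a : ℕ →₀ L} (ha : a ∈ Finsupp.supported L k (Set.Iic 1)) {n : ℕ}
    {v : ℕ →₀ L} (hv : v ∈ Finsupp.supported L k (Set.Iic n)) :
    loop β a v ∈ Finsupp.supported L k (Set.Iic (n + 1)) := by
  rw [loop, Finsupp.lsum_apply, Finsupp.sum, LinearMap.sum_apply]
  refine Submodule.sum_mem _ fun i hi => ?_
  rw [LinearMap.flip_apply, Finsupp.lsum_apply, Finsupp.sum, LinearMap.sum_apply]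
  refine Submodule.sum_mem _ fun j hj => ?_
  have hi' : i ≤ 1 := ha hi
  have hj' : j ≤ n := hv hj
  exact Finsupp.single_mem_supported k _ (Set.mem_Iic.2 (by omega))

lemma jacobsonSum_loop_mem_supported {p : ℕ} (hp : 2 ≤ p) {a b : ℕ →₀ L}
    (ha : a ∈ Finsupp.supported L k (Set.Iic 1)) (hb : b ∈ Finsupp.supported L k (Set.Iic 1))
    (haa : loop β a a = 0) (hba : loop β b a ∈ Finsupp.supported L k (Set.Iic 1)) :
    jacobsonSum (loop β) p a b ∈ Finsupp.supported L k (Set.Iic (p - 1)) :=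
  jacobsonSum_mem_filtration (D := fun n => Finsupp.supported L k (Set.Iic n))
    (fun _ _ hv => loop_mem_supported ha hv) (fun _ _ hv => loop_mem_supported hb hv) haa hba hp

lemma map_evalAt_jacobsonSum (p : ℕ) (c : k) (u v : ℕ →₀ L) :
    evalAt L c (jacobsonSum (loop β) p u v) = jacobsonSum β p (evalAt L c u) (evalAt L c v) :=
  map_jacobsonSum u v (evalAt L c) (evalAt_loop c) p

section Cocycle

variable (p : ℕ) [hp : Fact p.Prime] [CharP k p]

/-- The two sides differ, for `y` replaced by `t y`, by a polynomial in `t` of degree less than `p`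
that acts trivially under `loopRep`. -/
lemma IsLieBracket.jacobsonSum_comm (hβ : IsLieBracket β) (x y : L) :
    jacobsonSum β p x y = jacobsonSum β p y x := by
  have hp2 := hp.out.two_le
  set X : ℕ →₀ L := Finsupp.single 0 x with hX
  set Y : ℕ →₀ L := Finsupp.single 1 y with hY
  have hXs : X ∈ Finsupp.supported L k (Set.Iic 1) := Finsupp.single_mem_supported k _ (by simp)
  have hYs : Y ∈ Finsupp.supported L k (Set.Iic 1) := Finsupp.single_mem_supported k _ (by simp)
  have key := evalAt_one_eq_evalAt_zero (β := β) p
    (u := jacobsonSum (loop β) p X Y - jacobsonSum (loop β) p Y X)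
    (by
      simp only [map_sub, map_jacobsonSum_eq p (loopRep β) (loopRep_loop hβ)]
      rw [add_comm (loopRep β X)]
      abel)
    (Submodule.sub_mem _
      (jacobsonSum_loop_mem_supported hp2 hXs hYs (by simp [hX, hβ.self])
        (by
          rw [hX, hY, loop_single]
          exact Finsupp.single_mem_supported k _ (by simp)))
      (jacobsonSum_loop_mem_supported hp2 hYs hXs (by simp [hY, hβ.self])
        (by
          rw [hX, hY, loop_single]
          exact Finsupp.single_mem_supported k _ (by simp))))
  simp only [map_sub, map_evalAt_jacobsonSum, hX, hY, evalAt_single] at key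
  rw [← sub_eq_zero]
  simpa [jacobsonSum_eq_zero β _ _ hp2, hβ.self] using key

/-- Both sides become `(x + y + z)^p - x^p - y^p - z^p` in an associative algebra. They agree
in `L` itself since, for `z` replaced by `t z`, their difference is a polynomial in `t` of degree
less than `p` without constant term that acts trivially under `loopRep`. -/
lemma IsLieBracket.jacobsonSum_cocycle (hβ : IsLieBracket β) (x y z : L) :
    jacobsonSum β p x y + jacobsonSum β p (x + y) z =
      jacobsonSum β p y z + jacobsonSum β p x (y + z) := by
  have hp2 := hp.out.two_le
  set Z : ℕ →₀ L := Finsupp.single 1 z with hZ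
  have hs : ∀ v : L, (Finsupp.single 0 v : ℕ →₀ L) ∈ Finsupp.supported L k (Set.Iic 1) :=
    fun v => Finsupp.single_mem_supported k _ (by simp)
  have hZs : Z ∈ Finsupp.supported L k (Set.Iic 1) := Finsupp.single_mem_supported k _ (by simp)
  have hmem : ∀ v w : L, ∀ Z' ∈ ({0, Z} : Set (ℕ →₀ L)),
      jacobsonSum (loop β) p (Finsupp.single 0 v) (Finsupp.single 0 w + Z') ∈
        Finsupp.supported L k (Set.Iic (p - 1)) := by
    intro v w Z' hZ'
    have hZ's : Z' ∈ Finsupp.supported L k (Set.Iic 1) := by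
      rcases hZ' with rfl | rfl
      exacts [Submodule.zero_mem _, hZs]
    refine jacobsonSum_loop_mem_supported hp2 (hs v) (Submodule.add_mem _ (hs w) hZ's)
      (by simp [hβ.self]) ?_
    rw [map_add, LinearMap.add_apply, loop_single]
    refine Submodule.add_mem _ (hs _) ?_
    rcases hZ' with rfl | rfl
    · simp
    · rw [hZ, loop_single]
      exact Finsupp.single_mem_supported k _ (by simp)
  have h1 := hmem x y 0 (by simp)
  have h2 := hmem (x + y) 0 Z (by simp)
  have h3 := hmem y 0 Z (by simp)
  have h4 := hmem x y Z (by simp)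
  rw [add_zero] at h1
  rw [Finsupp.single_zero, zero_add] at h2 h3
  have key := evalAt_one_eq_evalAt_zero (β := β) p
    (u := jacobsonSum (loop β) p (Finsupp.single 0 x) (Finsupp.single 0 y)
      + jacobsonSum (loop β) p (Finsupp.single 0 (x + y)) Z
      - jacobsonSum (loop β) p (Finsupp.single 0 y) Z
      - jacobsonSum (loop β) p (Finsupp.single 0 x) (Finsupp.single 0 y + Z))
    (by
      simp only [map_sub, map_add, map_jacobsonSum_eq p (loopRep β) (loopRep_loop hβ),
        Finsupp.single_add]
      rw [add_assoc (loopRep β _) (loopRep β _) (loopRep β _)]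
      abel)
    (Submodule.sub_mem _ (Submodule.sub_mem _ (Submodule.add_mem _ h1 h2) h3) h4)
  simp only [map_sub, map_add, map_evalAt_jacobsonSum, hZ, evalAt_single] at key
  have h0 : ∀ v : L, jacobsonSum β p v 0 = 0 := fun v =>
    jacobsonSum_eq_zero β _ _ hp2 (hβ.self v) (by simp)
  simp only [pow_zero, pow_one, one_smul, zero_smul, h0, add_zero, sub_zero, sub_self] at key
  rw [← sub_eq_zero, ← key]
  abel

/-- If every element `x` of a Lie algebra has candidates `a`, with `R x a`, for the value of a
`p`-map, and if these are compatible with Jacobson's formula and with scalars, then a `p`-map can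
be selected among them. The pairs with `R x a` form a vector space under
`(x, a) + (y, b) = (x + y, a + b + s(x, y))` and `c (x, a) = (c x, c^p a)`, and the `p`-map is a
linear section of the projection to the first component. -/
theorem IsLieBracket.exists_pmap (hβ : IsLieBracket β) (R : L → L → Prop)
    (hadd : ∀ x y a b, R x a → R y b → R (x + y) (a + b + jacobsonSum β p x y))
    (hsmul : ∀ (c : k) x a, R x a → R (c • x) (c ^ p • a)) (hR : ∀ x, ∃ a, R x a) :
    ∃ P : L → L, (∀ x y, P (x + y) = P x + P y + jacobsonSum β p x y) ∧
      (∀ (c : k) x, P (c • x) = c ^ p • P x) ∧ ∀ x, R x (P x) := by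
  have hp2 := hp.out.two_le
  have hcomm : ∀ x y, β y x = 0 → jacobsonSum β p x y = 0 := fun x y h =>
    jacobsonSum_eq_zero β _ _ hp2 (hβ.self x) h
  have hR0 : R 0 0 := by
    obtain ⟨a, ha⟩ := hR 0
    simpa [hp.out.ne_zero] using hsmul 0 0 a ha
  -- negatives are multiples by the scalar `-1`, which acts on values of the `p`-map by `(-1)^p`
  have hneg : (-1 : k) ^ p = -1 := by
    have h := neg_one_pow_pred k p
    rw [← Nat.sub_add_cancel hp.out.one_le, pow_succ, h, one_mul]
  let F := {q : L × L // R q.1 q.2}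
  let _ : SMul k F := ⟨fun c q => ⟨(c • q.1.1, c ^ p • q.1.2), hsmul _ _ _ q.2⟩⟩
  let _ : Add F := ⟨fun q r => ⟨(q.1.1 + r.1.1, q.1.2 + r.1.2 + jacobsonSum β p q.1.1 r.1.1),
    hadd _ _ _ _ q.2 r.2⟩⟩
  let _ : Zero F := ⟨⟨(0, 0), hR0⟩⟩
  let _ : Neg F := ⟨fun q => (-1 : k) • q⟩
  let _ : AddGroup F := AddGroup.ofLeftAxioms
      (fun q r s => Subtype.ext <| Prod.ext (add_assoc _ _ _) <| by
        change q.1.2 + r.1.2 + jacobsonSum β p q.1.1 r.1.1 + s.1.2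
            + jacobsonSum β p (q.1.1 + r.1.1) s.1.1 =
          q.1.2 + (r.1.2 + s.1.2 + jacobsonSum β p r.1.1 s.1.1)
            + jacobsonSum β p q.1.1 (r.1.1 + s.1.1)
        have h := hβ.jacobsonSum_cocycle p q.1.1 r.1.1 s.1.1
        rw [← sub_eq_zero] at h ⊢
        rw [← h]
        abel)
      (fun q => Subtype.ext <| Prod.ext (zero_add _) <| by
        change 0 + q.1.2 + jacobsonSum β p 0 q.1.1 = q.1.2
        rw [hcomm _ _ (by simp), zero_add, add_zero])
      (fun q => Subtype.ext <| Prod.ext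
        (by change (-1 : k) • q.1.1 + q.1.1 = 0; simp) <| by
        change (-1 : k) ^ p • q.1.2 + q.1.2 + jacobsonSum β p ((-1 : k) • q.1.1) q.1.1 = 0
        rw [hcomm _ _ (by simp [hβ.self]), hneg]
        simp)
  let _ : AddCommGroup F :=
    { add_comm := fun q r => Subtype.ext <| Prod.ext (add_comm _ _) <| by
        change q.1.2 + r.1.2 + jacobsonSum β p q.1.1 r.1.1 =
          r.1.2 + q.1.2 + jacobsonSum β p r.1.1 q.1.1
        rw [hβ.jacobsonSum_comm p, add_comm q.1.2] }
  let _ : Module k F :=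
    { one_smul := fun q => Subtype.ext <| Prod.ext (one_smul _ _) <| by
        change (1 : k) ^ p • q.1.2 = q.1.2
        simp
      mul_smul := fun c d q => Subtype.ext <| Prod.ext (mul_smul _ _ _) <| by
        change (c * d) ^ p • q.1.2 = c ^ p • d ^ p • q.1.2
        rw [mul_pow, mul_smul]
      smul_zero := fun c => Subtype.ext <| Prod.ext (smul_zero _) (smul_zero _)
      smul_add := fun c q r => Subtype.ext <| Prod.ext (smul_add _ _ _) <| by
        change c ^ p • (q.1.2 + r.1.2 + jacobsonSum β p q.1.1 r.1.1) =
          c ^ p • q.1.2 + c ^ p • r.1.2 + jacobsonSum β p (c • q.1.1) (c • r.1.1)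
        rw [jacobsonSum_smul β _ _ c hp.out.one_le, smul_add, smul_add]
      add_smul := fun c d q => Subtype.ext <| Prod.ext (add_smul _ _ _) <| by
        change (c + d) ^ p • q.1.2 =
          c ^ p • q.1.2 + d ^ p • q.1.2 + jacobsonSum β p (c • q.1.1) (d • q.1.1)
        rw [hcomm _ _ (by simp [hβ.self]), add_zero, add_pow_char c d p, add_smul]
      zero_smul := fun q => Subtype.ext <| Prod.ext (zero_smul _ _) <| by
        change (0 : k) ^ p • q.1.2 = 0
        simp [hp.out.ne_zero] }
  let π : F →ₗ[k] L :=
    { toFun := fun q => q.1.1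
      map_add' := fun _ _ => rfl
      map_smul' := fun _ _ => rfl }
  obtain ⟨σ, hσ⟩ := π.exists_rightInverse_of_surjective <| LinearMap.range_eq_top.2 fun x =>
    let ⟨a, ha⟩ := hR x
    ⟨⟨(x, a), ha⟩, rfl⟩
  have hσ' : ∀ x, (σ x).1.1 = x := LinearMap.congr_fun hσ
  refine ⟨fun x => (σ x).1.2, fun x y => ?_, fun c x => ?_, fun x => ?_⟩
  · have h : (σ (x + y)).1.2 = (σ x).1.2 + (σ y).1.2 + jacobsonSum β p (σ x).1.1 (σ y).1.1 := by
      rw [map_add]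
      rfl
    rwa [hσ', hσ'] at h
  · have h : (σ (c • x)).1.2 = c ^ p • (σ x).1.2 := by
      rw [map_smul]
      rfl
    exact h
  · have h := (σ x).2
    rwa [hσ'] at h

end Cocycle

end Loop

/-! ### Even elements of Lie superalgebras -/

section Super

@[simp] lemma superSign_zero_left (j : ZMod 2) : superSign 0 j = 1 := by simp [superSign]

@[simp] lemma superSign_zero_right (i : ZMod 2) : superSign i 0 = 1 := by simp [superSign]

@[simp] lemma superSign_one_one : superSign 1 1 = -1 := by simp [superSign, ZMod.val_one]

variable {k : Type w} [Field k]

lemma exists_even_add_odd {V : Type u} [AddCommGroup V] [Module k V] [SuperSpace k V] (x : V) :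
    ∃ x₀ ∈ gr k V 0, ∃ x₁ ∈ gr k V 1, x₀ + x₁ = x :=
  Submodule.mem_sup.1 <| (SuperSpace.isCompl (k := k) (V := V)).sup_eq_top ▸ Submodule.mem_top

lemma eq_zero_of_even_of_odd {V : Type u} [AddCommGroup V] [Module k V] [SuperSpace k V] {x : V}
    (h0 : x ∈ gr k V 0) (h1 : x ∈ gr k V 1) : x = 0 :=
  Submodule.disjoint_def.1 (SuperSpace.isCompl (k := k) (V := V)).disjoint x h0 h1

/-- Two linear maps agree if they agree on homogeneous elements. -/
lemma linearMap_ext_homogeneous {V : Type u} {W : Type v} [AddCommGroup V] [Module k V]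
    [SuperSpace k V] [AddCommGroup W] [Module k W] {φ ψ : V →ₗ[k] W}
    (h : ∀ i, ∀ x ∈ gr k V i, φ x = ψ x) : φ = ψ := by
  ext x
  obtain ⟨x₀, h₀, x₁, h₁, rfl⟩ := exists_even_add_odd (k := k) x
  rw [map_add, map_add, h 0 x₀ h₀, h 1 x₁ h₁]

variable {E : Type u} [AddCommGroup E] [Module k E] [LieSuperalgebra k E]

lemma adj_apply (x y : E) : adj k x y = br k x y := rfl

/-- Skew-symmetry has no sign if one argument is even, even if the other is inhomogeneous. -/
lemma br_skew_of_even {e : E} (he : e ∈ gr k E 0) (y : E) : br k e y = -br k y e := by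
  refine LinearMap.congr_fun (f := LieSuperalgebra.bracket (k := k) e)
    (g := -(LieSuperalgebra.bracket (k := k)).flip e)
    (linearMap_ext_homogeneous (k := k) fun i x hx => ?_) y
  simpa using LieSuperalgebra.bracket_skew he hx

/-- The Jacobi identity for an even and an arbitrary element. -/
lemma adj_br {e : E} (he : e ∈ gr k E 0) (y : E) :
    adj k (br k e y) = adj k e * adj k y - adj k y * adj k e := by
  refine LinearMap.congr_fun (f := (LieSuperalgebra.bracket (k := k)).comp (adj k e))
    (g := commutator k (Module.End k E) (adj k e) ∘ₗ LieSuperalgebra.bracket (k := k))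
    (linearMap_ext_homogeneous (k := k) fun i x hx => ?_) y
  refine linearMap_ext_homogeneous (k := k) fun j z hz => ?_
  have h := LieSuperalgebra.bracket_jacobi he hx hz
  rw [superSign_zero_left, one_smul] at h
  simpa using eq_sub_of_add_eq h.symm

lemma adj_pow_mem {e : E} (he : e ∈ gr k E 0) {i : ZMod 2} {y : E} (hy : y ∈ gr k E i) (n : ℕ) :
    (adj k e ^ n) y ∈ gr k E i := by
  induction n with
  | zero => simpa
  | succ n ih =>
    rw [pow_succ', Module.End.mul_apply]
    simpa using LieSuperalgebra.bracket_mem he ih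

variable (p : ℕ) [hp : Fact p.Prime] [CharP k p]

/-- The `p`-th power of `ad e`, for an even element `e`, is a derivation. -/
lemma adj_pow_prime_br {e : E} (he : e ∈ gr k E 0) (y z : E) :
    (adj k e ^ p) (br k y z) = br k ((adj k e ^ p) y) z + br k y ((adj k e ^ p) z) := by
  -- `ad` intertwines `ad e` with the commutator with `ad e`, whose `p`-th power is the commutator
  -- with `(ad e)^p`
  set c : Module.End k (Module.End k E) :=
    LinearMap.mulLeft k (adj k e) - LinearMap.mulRight k (adj k e) with hc
  have h1 : ∀ n, adj k ((adj k e ^ n) y) = (c ^ n) (adj k y) := by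
    intro n
    induction n with
    | zero => simp
    | succ n ih =>
      rw [pow_succ', Module.End.mul_apply, pow_succ', Module.End.mul_apply, ← ih]
      exact adj_br he _
  have h2 : c ^ p = LinearMap.mulLeft k (adj k e ^ p) - LinearMap.mulRight k (adj k e ^ p) := by
    rw [hc, sub_pow_prime_of_commute k p (LinearMap.commute_mulLeft_right _ _),
      LinearMap.pow_mulLeft, LinearMap.pow_mulRight]
  have h3 := LinearMap.congr_fun (h1 p) z
  rw [h2] at h3
  simp only [LinearMap.sub_apply, LinearMap.mulLeft_apply, LinearMap.mulRight_apply,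
    Module.End.mul_apply] at h3
  rw [adj_apply, adj_apply, adj_apply] at h3
  rw [h3]
  abel

variable (k E) in
/-- The bracket of the Lie algebra of even elements. -/
noncomputable def evenBracket : gr k E 0 →ₗ[k] gr k E 0 →ₗ[k] gr k E 0 :=
  LinearMap.mk₂ k
    (fun x y => ⟨br k (x : E) y, by simpa using LieSuperalgebra.bracket_mem x.2 y.2⟩)
    (fun _ _ _ => Subtype.ext (by simp [br])) (fun _ _ _ => Subtype.ext (by simp [br]))
    (fun _ _ _ => Subtype.ext (by simp [br])) (fun _ _ _ => Subtype.ext (by simp [br]))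

@[simp]
lemma coe_evenBracket (x y : gr k E 0) : (evenBracket k E x y : E) = br k (x : E) y := rfl

lemma isLieBracket_evenBracket (h2 : (2 : k) ≠ 0) : IsLieBracket (evenBracket k E) where
  self x := by
    have h := br_skew_of_even x.2 (x : E)
    rw [eq_neg_iff_add_eq_zero, ← two_smul k, smul_eq_zero, or_iff_right h2] at h
    exact Subtype.ext h
  jacobi x y z := Subtype.ext <| by
    simpa using LieSuperalgebra.bracket_jacobi x.2 y.2 z.2

omit hp [CharP k p] in
lemma coe_jacobsonSum (x y : gr k E 0) :
    ((jacobsonSum (evenBracket k E) p x y : gr k E 0) : E) =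
      jacobsonSum (LieSuperalgebra.bracket (k := k)) p (x : E) y :=
  map_jacobsonSum x y (gr k E 0).subtype (fun _ _ => rfl) p

lemma adj_jacobsonSum (x y : gr k E 0) :
    adj k ((jacobsonSum (evenBracket k E) p x y : gr k E 0) : E) =
      adj k (x + y : E) ^ p - adj k (x : E) ^ p - adj k (y : E) ^ p := by
  have h := map_jacobsonSum_eq p
    ((LieSuperalgebra.bracket (k := k)).comp (gr k E 0).subtype : gr k E 0 →ₗ[k] Module.End k E)
    (β := evenBracket k E) (fun u v => adj_br u.2 _) x y
  rw [adj, adj, map_add]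
  exact h

omit hp [CharP k p] in
lemma pow_add_eq [PMap k p E] (x y : gr k E 0) :
    pow k p (x + y) = pow k p x + pow k p y + jacobsonSum (evenBracket k E) p x y := by
  rw [coe_jacobsonSum]
  exact PMap.pmap_add x y

omit hp [CharP k p] in
lemma pow_smul_eq [PMap k p E] (c : k) (x : gr k E 0) :
    pow k p (c • x) = c ^ p • pow k p x :=
  congrArg Subtype.val (PMap.pmap_smul c x)

end Super

/-! ### Even sections of extensions -/

section Sections

variable {k : Type w} {g : Type u} {M : Type v} {E : Type (max u v)} [Field k]
  [AddCommGroup g] [Module k g] [LieSuperalgebra k g]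
  [AddCommGroup M] [Module k M] [LieSuperalgebra k M] [SuperModule k g M]
  [AddCommGroup E] [Module k E] [LieSuperalgebra k E]

namespace Extension

variable (X : Extension k g M E)

lemma proj_incl (m : M) : X.proj (X.incl m) = 0 := by
  have : X.incl m ∈ LinearMap.ker X.proj := X.exact ▸ LinearMap.mem_range_self _ m
  exact this

lemma mem_of_incl_mem {i : ZMod 2} {m : M} (h : X.incl m ∈ gr k E i) : m ∈ gr k M i := by
  obtain ⟨m₀, h₀, m₁, h₁, rfl⟩ := exists_even_add_odd (k := k) m
  have e₀ := X.incl_mem h₀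
  have e₁ := X.incl_mem h₁
  rw [map_add] at h
  obtain rfl | rfl := (by decide : ∀ i : ZMod 2, i = 0 ∨ i = 1) i
  · have : m₁ = 0 := X.incl_injective <| by
      rw [map_zero]
      exact eq_zero_of_even_of_odd (by simpa using Submodule.sub_mem _ h e₀) e₁
    simpa [this] using h₀
  · have : m₀ = 0 := X.incl_injective <| by
      rw [map_zero]
      exact eq_zero_of_even_of_odd e₀ (by simpa using Submodule.sub_mem _ h e₁)
    simpa [this] using h₁

lemma exists_incl_of_proj_eq_zero {e : E} (he : X.proj e = 0) {i : ZMod 2} (hi : e ∈ gr k E i) :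
    ∃ m ∈ gr k M i, X.incl m = e := by
  have : e ∈ LinearMap.range X.incl := X.exact ▸ he
  obtain ⟨m, rfl⟩ := this
  exact ⟨m, X.mem_of_incl_mem hi, rfl⟩

lemma incl_bracket_of_even {m : M} (hm : m ∈ gr k M 0) (e : E) :
    br k (X.incl m) e = -X.incl (op k (X.proj e) m) := by
  rw [br_skew_of_even (X.incl_mem hm), X.bracket_incl]

lemma adj_pow_incl (e : E) (m : M) (n : ℕ) :
    (adj k e ^ n) (X.incl m) = X.incl ((SuperModule.act (k := k) (M := M) (X.proj e) ^ n) m) := by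
  induction n with
  | zero => simp
  | succ n ih => rw [pow_succ', pow_succ', Module.End.mul_apply, ih, adj_apply, X.bracket_incl,
    Module.End.mul_apply]

/-- The projection, restricted to even elements. -/
noncomputable def evenProj : gr k E 0 →ₗ[k] gr k g 0 := X.proj.restrict fun _ => X.proj_mem

lemma evenProj_jacobsonSum (p : ℕ) (x y : gr k E 0) :
    X.evenProj (jacobsonSum (evenBracket k E) p x y) =
      jacobsonSum (evenBracket k g) p (X.evenProj x) (X.evenProj y) :=
  map_jacobsonSum (β := evenBracket k E) (γ := evenBracket k g) x y X.evenProj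
    (fun u v => Subtype.ext (X.proj_bracket (u : E) v)) p

/-- An even linear section `s` of the projection of an extension, together with the cocycle
`f (x, y) = [s x, s y] - s [x, y]` that it defines. -/
structure IsSection (s : g →ₗ[k] E) (f : g →ₗ[k] g →ₗ[k] M) : Prop where
  even : ∀ i : ZMod 2, ∀ x ∈ gr k g i, s x ∈ gr k E i
  proj_apply : ∀ x, X.proj (s x) = x
  cocycle : ∀ x y, X.incl (f x y) = br k (s x) (s y) - s (br k x y)

namespace IsSection

variable {X} {s : g →ₗ[k] E} {f : g →ₗ[k] g →ₗ[k] M} (hs : X.IsSection s f)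
include hs

lemma adj_pow_apply (x y : g) (n : ℕ) :
    (adj k (s x) ^ n) (s y) = s ((adj k x ^ n) y) + X.incl (∑ i ∈ Finset.range n,
      (SuperModule.act (k := k) (M := M) x ^ i) (f x ((adj k x ^ (n - 1 - i)) y))) := by
  induction n with
  | zero => simp
  | succ n ih =>
    rw [pow_succ', Module.End.mul_apply, ih, map_add, adj_apply, adj_apply, X.bracket_incl,
      hs.proj_apply, Finset.sum_range_succ', map_add X.incl, op, map_sum,
      add_comm (X.incl _) (X.incl _), ← add_assoc]
    congr 1
    · rw [pow_zero, Module.End.one_apply, hs.cocycle, pow_succ', Module.End.mul_apply]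
      simp
    · congr 1
      refine Finset.sum_congr rfl fun i _ => ?_
      rw [pow_succ', Module.End.mul_apply]
      congr 5
      omega

lemma decompose (e : E) : ∃ x m, e = s x + X.incl m := by
  have : e - s (X.proj e) ∈ LinearMap.range X.incl :=
    X.exact ▸ by simp [LinearMap.mem_ker, hs.proj_apply]
  obtain ⟨m, hm⟩ := this
  exact ⟨X.proj e, m, by rw [hm]; abel⟩

variable {p : ℕ} [PMap k p g]

/-- `Φ_{f,x}` is the difference of the derivations `(ad s(x))^p` and `ad s(x^[p])`. -/
lemma incl_phiCochain (x : gr k g 0) (y : g) :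
    X.incl (phiCochain p f x y) =
      (adj k (s x) ^ p) (s y) - br k (s (pow k p x)) (s y) := by
  have h1 : X.incl (f y (pow k p x)) = -X.incl (f (pow k p x) y) := by
    rw [hs.cocycle, hs.cocycle, br_skew_of_even (hs.even 0 _ (PMap.pmap (p := p) x).2) (s y),
      br_skew_of_even (PMap.pmap (p := p) x).2 y, map_neg]
    abel
  have h2 : phiCochain p f x y = ∑ i ∈ Finset.range p, (SuperModule.act (k := k) (M := M)
      (x : g) ^ i) (f (x : g) ((adj k (x : g) ^ (p - 1 - i)) y)) + f y (pow k p x) := by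
    simp [phiCochain]
  rw [h2, map_add, h1, hs.cocycle, hs.adj_pow_apply, PMap.bracket_pmap]
  abel

variable [hp : Fact p.Prime] [CharP k p]

/-- `Φ_{f,x}` is a `1`-cocycle. -/
lemma phiCochain_mem_Z1 (hres : IsRestrictedModule k p g M) (x : gr k g 0) :
    phiCochain p f x ∈ Z1 k g M := by
  have hx : s x ∈ gr k E 0 := hs.even 0 _ x.2
  have hx' : s (pow k p x) ∈ gr k E 0 := hs.even 0 _ (PMap.pmap (p := p) x).2
  -- this derivation of `E` vanishes on `M`, so that it descends to a derivation from `g` to `M`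
  set D : Module.End k E := adj k (s x) ^ p - adj k (s (pow k p x)) with hD
  have hDs : ∀ y, D (s y) = X.incl (phiCochain p f x y) := fun y => (hs.incl_phiCochain x y).symm
  have hDi : ∀ m, D (X.incl m) = 0 := by
    intro m
    rw [hD, LinearMap.sub_apply, X.adj_pow_incl, adj_apply, X.bracket_incl, hs.proj_apply,
      hs.proj_apply, op, hres, sub_self]
  have hDb : ∀ y z, D (br k y z) = br k (D y) z + br k y (D z) := by
    intro y z
    have h1 := adj_pow_prime_br p hx y z
    have h2 := LinearMap.congr_fun (adj_br hx' y) z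
    simp only [LinearMap.sub_apply, Module.End.mul_apply] at h2
    simp only [hD, LinearMap.sub_apply, h1, adj, br, map_sub] at h2 ⊢
    rw [h2]
    abel
  have heven : ∀ i, ∀ y ∈ gr k g i, phiCochain p f x y ∈ gr k M i := by
    intro i y hy
    refine X.mem_of_incl_mem ?_
    rw [hs.incl_phiCochain]
    refine Submodule.sub_mem _ (adj_pow_mem hx (hs.even i y hy) p) ?_
    simpa using LieSuperalgebra.bracket_mem hx' (hs.even i y hy)
  refine ⟨heven, fun i j y hy z hz => X.incl_injective ?_⟩
  have h1 : br k (s y) (s z) = s (br k y z) + X.incl (f y z) := by rw [hs.cocycle]; abel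
  have h2 := hDb (s y) (s z)
  rw [h1, map_add, hDs, hDi, hDs, hDs, add_zero, X.bracket_incl (s y), hs.proj_apply,
    show br k (X.incl (phiCochain p f x y)) (s z) = -(superSign i j • br k (s z) _) from
      LieSuperalgebra.bracket_skew (X.incl_mem (heven i y hy)) (hs.even j z hz), X.bracket_incl,
    hs.proj_apply] at h2
  rw [map_sub, map_sub, h2, map_zsmul, map_zero]
  abel

omit hp [CharP k p] in
lemma phiCochain_smul (c : k) (x : gr k g 0) :
    phiCochain p f (c • x) = c ^ p • phiCochain p f x := by
  ext y
  refine X.incl_injective ?_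
  rw [LinearMap.smul_apply, map_smul, hs.incl_phiCochain, hs.incl_phiCochain, pow_smul_eq]
  simp [br, _root_.smul_pow, smul_sub]

/-- `Φ_{f,x}` is additive in `x` up to coboundaries. -/
lemma phiCochain_add_sub_mem_B1 (x y : gr k g 0) :
    phiCochain p f (x + y) - (phiCochain p f x + phiCochain p f y) ∈ B1 k g M := by
  let sx : gr k E 0 := ⟨s x, hs.even 0 _ x.2⟩
  let sy : gr k E 0 := ⟨s y, hs.even 0 _ y.2⟩
  set J : gr k E 0 := jacobsonSum (evenBracket k E) p sx sy with hJ
  set j : gr k g 0 := jacobsonSum (evenBracket k g) p x y with hj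
  have hproj : X.proj J = j := by
    have h := congrArg Subtype.val (X.evenProj_jacobsonSum p sx sy)
    rw [show X.evenProj sx = x from Subtype.ext (hs.proj_apply _),
      show X.evenProj sy = y from Subtype.ext (hs.proj_apply _)] at h
    exact h
  obtain ⟨m, hm, hm'⟩ := X.exists_incl_of_proj_eq_zero (e := J - s j) (i := 0)
    (by rw [map_sub, hproj, hs.proj_apply, sub_self])
    (Submodule.sub_mem _ J.2 (hs.even 0 _ j.2))
  refine ⟨-m, Submodule.neg_mem _ hm, fun z => X.incl_injective ?_⟩
  have h1 := LinearMap.congr_fun (adj_jacobsonSum p sx sy) (s z)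
  have h2 := X.incl_bracket_of_even hm (s z)
  rw [hm', hs.proj_apply] at h2
  simp only [map_sub, LinearMap.sub_apply, LinearMap.add_apply, map_add, hs.incl_phiCochain,
    pow_add_eq, Submodule.coe_add, map_neg, ← hj, ← hJ, adj, br] at h1 h2 ⊢
  rw [← h2, h1]
  abel

omit hp [CharP k p] in
/-- In a restricted extension, `Φ_{f,x}` is the coboundary of `s(x^[p]) - s(x)^[p]`. -/
lemma phiCochain_mem_B1_of_isRestricted [PMap k p M] [PMap k p E] (hX : X.IsRestricted p)
    (x : gr k g 0) : phiCochain p f x ∈ B1 k g M := by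
  let sx : gr k E 0 := ⟨s x, hs.even 0 _ x.2⟩
  have hproj : X.proj (pow k p sx) = pow k p x := by
    rw [hX.proj_pow]
    congr
    exact hs.proj_apply _
  obtain ⟨m, hm, hm'⟩ := X.exists_incl_of_proj_eq_zero (e := pow k p sx - s (pow k p x)) (i := 0)
    (by rw [map_sub, hproj, hs.proj_apply, sub_self])
    (Submodule.sub_mem _ (PMap.pmap (p := p) sx).2 (hs.even 0 _ (PMap.pmap (p := p) x).2))
  refine ⟨-m, Submodule.neg_mem _ hm, fun y => X.incl_injective ?_⟩
  have h := X.incl_bracket_of_even hm (s y)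
  rw [hm', hs.proj_apply, br, map_sub, LinearMap.sub_apply] at h
  rw [hs.incl_phiCochain, op, map_neg, map_neg, ← h]
  exact congrArg (· - _) (PMap.bracket_pmap sx (s y)).symm

end IsSection

lemma adj_incl_pow (hM : ∀ m n : M, br k m n = 0) {m : M} (hm : m ∈ gr k M 0) :
    adj k (X.incl m) ^ 2 = 0 := by
  ext e
  rw [pow_two, Module.End.mul_apply, adj_apply _ e, X.incl_bracket_of_even hm e, map_neg, adj_apply,
    ← X.incl_bracket, hM]
  simp

section AbelianKernel

variable (p : ℕ) [hp : Fact p.Prime] [CharP k p]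

omit [CharP k p] in
lemma adj_incl_pow_prime (hM : ∀ m n : M, br k m n = 0) {m : M} (hm : m ∈ gr k M 0) :
    adj k (X.incl m) ^ p = 0 :=
  pow_eq_zero_of_le hp.out.two_le (X.adj_incl_pow hM hm)

omit [CharP k p] in
lemma proj_jacobsonSum_incl (h2 : (2 : k) ≠ 0) (e n : gr k E 0) (hn : X.proj n = 0) :
    X.proj (jacobsonSum (evenBracket k E) p e n : gr k E 0) = 0 := by
  have h := congrArg Subtype.val (X.evenProj_jacobsonSum p e n)
  rw [show X.evenProj n = 0 from Subtype.ext hn,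
    jacobsonSum_eq_zero (evenBracket k g) _ _ hp.out.two_le
      ((isLieBracket_evenBracket h2).self _) (by rw [map_zero, LinearMap.zero_apply])] at h
  exact h

/-- The class of `Φ_{f,x}` does not depend on the section. -/
lemma IsSection.phiCochain_sub_mem_B1 {X : Extension k g M E} {s s' : g →ₗ[k] E}
    {f f' : g →ₗ[k] g →ₗ[k] M} (hs : X.IsSection s f) (hs' : X.IsSection s' f') [PMap k p g]
    (h2 : (2 : k) ≠ 0) (hM : ∀ m n : M, br k m n = 0) (hres : IsRestrictedModule k p g M)
    (x : gr k g 0) : phiCochain p f' x - phiCochain p f x ∈ B1 k g M := by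
  have hdiff : ∀ x ∈ gr k g 0, ∃ m ∈ gr k M 0, X.incl m = s' x - s x := fun x hx =>
    X.exists_incl_of_proj_eq_zero (by rw [map_sub, hs.proj_apply, hs'.proj_apply, sub_self])
      (Submodule.sub_mem _ (hs'.even 0 x hx) (hs.even 0 x hx))
  obtain ⟨n, hn, hn'⟩ := hdiff x x.2
  obtain ⟨n₁, hn₁, hn₁'⟩ := hdiff (pow k p x) (PMap.pmap (p := p) x).2
  let sx : gr k E 0 := ⟨s x, hs.even 0 _ x.2⟩
  let nE : gr k E 0 := ⟨X.incl n, X.incl_mem hn⟩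
  obtain ⟨j, hj, hj'⟩ := X.exists_incl_of_proj_eq_zero
    (X.proj_jacobsonSum_incl p h2 sx nE (X.proj_incl n)) (Subtype.prop _)
  have hpow : adj k (s' x) ^ p = adj k (s x) ^ p + adj k (X.incl j) := by
    have h := adj_jacobsonSum p sx nE
    rw [← hj', show (sx + nE : E) = s' x from by
      change s x + X.incl n = s' x
      rw [hn']
      abel,
      show adj k (nE : E) ^ p = 0 from X.adj_incl_pow_prime p hM hn] at h
    rw [h]
    abel
  refine ⟨n₁ - j, Submodule.sub_mem _ hn₁ hj, fun y => X.incl_injective ?_⟩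
  obtain ⟨l, hl⟩ : ∃ l, X.incl l = s' y - s y := by
    have : s' y - s y ∈ LinearMap.range X.incl :=
      X.exact ▸ by simp [LinearMap.mem_ker, hs.proj_apply, hs'.proj_apply]
    exact this
  have hy : s' y = s y + X.incl l := by rw [hl]; abel
  have hx' : s' (pow k p x) = s (pow k p x) + X.incl n₁ := by rw [hn₁']; abel
  have e1 := X.incl_bracket_of_even hj (s' y)
  have e2 := X.incl_bracket_of_even hn₁ (s' y)
  have e3 : (adj k (s x) ^ p) (s' y) = (adj k (s x) ^ p) (s y) + X.incl (op k (pow k p x) l) := by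
    rw [hy, map_add, X.adj_pow_incl, hs.proj_apply, op, hres]
  have e4 : br k (s (pow k p x)) (s' y) =
      br k (s (pow k p x)) (s y) + X.incl (op k (pow k p x) l) := by
    have := X.bracket_incl (s (pow k p x)) l
    rw [hs.proj_apply] at this
    rw [hy, br, map_add, ← this]
  rw [hs'.proj_apply] at e1 e2
  rw [LinearMap.sub_apply, map_sub, hs.incl_phiCochain, hs'.incl_phiCochain, hpow, hx',
    LinearMap.add_apply, e3, adj_apply, e1, br, map_add, LinearMap.add_apply]
  simp only [br, op] at e2 e4 ⊢
  rw [e2, e4, map_sub, map_sub]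
  abel

/-- An extension with strongly abelian kernel is restricted, for a suitable `p`-map, if all the
cocycles `Φ_{f,x}` are coboundaries. -/
theorem IsSection.exists_pmap_isRestricted {X : Extension k g M E} {s : g →ₗ[k] E}
    {f : g →ₗ[k] g →ₗ[k] M} (hs : X.IsSection s f) [PMap k p g] [PMap k p M]
    (h2 : (2 : k) ≠ 0) (hM : IsStronglyAbelian k p M) (hres : IsRestrictedModule k p g M)
    (hf : ∀ x, phiCochain p f x ∈ B1 k g M) : ∃ _ : PMap k p E, X.IsRestricted p := by
  have hlie := isLieBracket_evenBracket (E := E) h2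
  -- `a` is an admissible `p`-th power of `e`
  let R : gr k E 0 → gr k E 0 → Prop := fun e a =>
    X.proj a = pow k p (X.evenProj e) ∧ adj k (a : E) = adj k (e : E) ^ p
  have hadd : ∀ x y a b, R x a → R y b →
      R (x + y) (a + b + jacobsonSum (evenBracket k E) p x y) := by
    rintro x y a b ⟨ha, ha'⟩ ⟨hb, hb'⟩
    constructor
    · have h := congrArg Subtype.val (X.evenProj_jacobsonSum p x y)
      rw [map_add X.evenProj, pow_add_eq, ← h, ← ha, ← hb]
      simp [evenProj]
    · have h := adj_jacobsonSum p x y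
      rw [← ha', ← hb'] at h
      rw [Submodule.coe_add x y, ← sub_eq_zero, ← sub_eq_zero.2 h]
      simp only [adj, Submodule.coe_add, map_add]
      abel
  have hsmul : ∀ (c : k) x a, R x a → R (c • x) (c ^ p • a) := by
    rintro c x a ⟨ha, ha'⟩
    constructor
    · rw [map_smul X.evenProj, pow_smul_eq, ← ha]
      simp
    · rw [Submodule.coe_smul, Submodule.coe_smul, adj, map_smul, ← adj, ha', adj, adj, map_smul,
        _root_.smul_pow]
  have hincl : ∀ u : gr k E 0, X.proj u = 0 → R u 0 := by
    intro u hu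
    obtain ⟨m, hm, hm'⟩ := X.exists_incl_of_proj_eq_zero hu u.2
    constructor
    · have : pow k p (0 : gr k g 0) = 0 := by
        have := pow_smul_eq p (0 : k) (0 : gr k g 0)
        rwa [smul_zero, zero_pow hp.out.ne_zero, zero_smul] at this
      rw [show X.evenProj u = 0 from Subtype.ext hu, this]
      simp
    · rw [← hm', X.adj_incl_pow_prime p hM.bracket_eq_zero hm]
      simp [adj]
  -- since `Φ_{f,x}` is the coboundary of `m`, the element `s(x^[p]) - m` is admissible for `s x`
  have hsec : ∀ x : gr k g 0, ∃ a, R ⟨s x, hs.even 0 _ x.2⟩ a := by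
    intro x
    obtain ⟨m, hm, hm'⟩ := hf x
    refine ⟨⟨s (pow k p x) - X.incl m, Submodule.sub_mem _ (hs.even 0 _ (PMap.pmap (p := p) x).2)
      (X.incl_mem hm)⟩, ?_, ?_⟩
    · rw [map_sub, hs.proj_apply, X.proj_incl, sub_zero]
      exact congrArg (pow k p (g := g)) (Subtype.ext (hs.proj_apply _).symm)
    · ext e
      obtain ⟨y, n, rfl⟩ := hs.decompose e
      have e1 := hs.incl_phiCochain (p := p) x y
      have e2 := X.incl_bracket_of_even hm (s y)
      have e3 := X.bracket_incl (s (pow k p x)) n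
      have e4 : br k (X.incl m) (X.incl n) = 0 := by
        rw [← X.incl_bracket, hM.bracket_eq_zero, map_zero]
      rw [hm'] at e1
      rw [hs.proj_apply] at e2 e3
      rw [map_add, map_add, X.adj_pow_incl, hs.proj_apply, ← hres, ← op, ← e3]
      simp only [adj, br, map_sub, LinearMap.sub_apply] at e1 e2 e4 ⊢
      rw [e4, e2, e1]
      abel
  have hR : ∀ e, ∃ a, R e a := by
    intro e
    let x := X.evenProj e
    let u : gr k E 0 := e - ⟨s x, hs.even 0 _ x.2⟩
    have hu : X.proj u = 0 := by
      simp [u, x, evenProj, hs.proj_apply]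
    obtain ⟨a, ha⟩ := hsec x
    have := hadd _ _ _ _ ha (hincl u hu)
    rw [add_sub_cancel] at this
    exact ⟨_, this⟩
  obtain ⟨P, hPadd, hPsmul, hPR⟩ := hlie.exists_pmap p R hadd hsmul hR
  -- `P` is semilinear on the abelian ideal `M`; subtracting `P ∘ σ`, for the projection `σ` to `M`
  -- along the section, makes it vanish there
  let σ : gr k E 0 →ₗ[k] gr k E 0 :=
    LinearMap.id - (s.restrict (hs.even 0)) ∘ₗ X.evenProj
  have hσ : ∀ e, X.proj (σ e) = 0 := by
    intro e
    simp [σ, evenProj, hs.proj_apply]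
  have hσ_incl : ∀ e : gr k E 0, X.proj e = 0 → σ e = e := by
    intro e he
    have : X.evenProj e = 0 := Subtype.ext he
    simp [σ, this]
  have habel : ∀ u v : gr k E 0, X.proj u = 0 → X.proj v = 0 → evenBracket k E u v = 0 := by
    intro u v hu hv
    obtain ⟨m, -, hm⟩ := X.exists_incl_of_proj_eq_zero hu u.2
    obtain ⟨n, -, hn⟩ := X.exists_incl_of_proj_eq_zero hv v.2
    refine Subtype.ext ?_
    rw [coe_evenBracket, ← hm, ← hn, ← X.incl_bracket, hM.bracket_eq_zero, map_zero]
    rfl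
  have hPσ_add : ∀ x y, P (σ (x + y)) = P (σ x) + P (σ y) := by
    intro x y
    rw [map_add, hPadd, jacobsonSum_eq_zero _ _ _ hp.out.two_le (hlie.self _)
      (habel _ _ (hσ _) (hσ _)), add_zero]
  have hPσ : ∀ e, X.proj (P (σ e)) = 0 ∧ adj k (P (σ e) : E) = 0 := by
    intro e
    have h1 := hPR (σ e)
    have h0 := hincl _ (hσ e)
    refine ⟨?_, ?_⟩
    · rw [h1.1, ← h0.1]
      simp
    · rw [h1.2, ← h0.2]
      simp [adj]
  let _ : PMap k p E :=
    { pmap := fun e => P e - P (σ e)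
      pmap_smul := fun c e => by rw [map_smul, hPsmul, hPsmul, smul_sub]
      bracket_pmap := fun e y => by
        have h1 := LinearMap.congr_fun (hPR e).2 y
        have h3 := LinearMap.congr_fun (hPσ e).2 y
        rw [LinearMap.zero_apply] at h3
        rw [← h1, ← sub_zero (adj k (P e : E) y), Submodule.coe_sub, br, map_sub,
          LinearMap.sub_apply]
        exact congrArg _ h3
      pmap_add := fun x y => by
        have h := coe_jacobsonSum p x y
        rw [hPadd, hPσ_add]
        simp only [Submodule.coe_sub, Submodule.coe_add, h]
        rw [show ∑ i ∈ Finset.Icc 1 (p - 1), jacobsonTerm k p i (x : E) y =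
          jacobsonSum (LieSuperalgebra.bracket (k := k)) p (x : E) y from rfl]
        abel }
  refine ⟨inferInstance, ⟨fun m => ?_, fun e => ?_⟩⟩
  · rw [hM.pow_eq_zero, map_zero]
    change (0 : E) = (P ⟨X.incl m, X.incl_mem m.2⟩ - P (σ ⟨X.incl m, X.incl_mem m.2⟩) : gr k E 0)
    rw [hσ_incl _ (X.proj_incl _), sub_self]
    rfl
  · change X.proj (P e - P (σ e) : gr k E 0) = _
    rw [Submodule.coe_sub, map_sub, (hPσ e).1, sub_zero]
    exact (hPR e).1

end AbelianKernel

end Extension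

end Sections

/-! ### The extension defined by a cocycle -/

section CocycleExtension

/-- The superspace `g × M`. -/
@[reducible]
def prodSuperSpace (k : Type w) (g : Type u) (M : Type v) [Field k] [AddCommGroup g]
    [Module k g] [SuperSpace k g] [AddCommGroup M] [Module k M] [SuperSpace k M] :
    SuperSpace k (g × M) where
  part i := (gr k g i).prod (gr k M i)
  isCompl := by
    refine IsCompl.of_eq ?_ ?_
    · rw [Submodule.prod_inf_prod, (SuperSpace.isCompl (k := k) (V := g)).inf_eq_bot,
        (SuperSpace.isCompl (k := k) (V := M)).inf_eq_bot, Submodule.prod_bot]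
    · rw [Submodule.prod_sup_prod, (SuperSpace.isCompl (k := k) (V := g)).sup_eq_top,
        (SuperSpace.isCompl (k := k) (V := M)).sup_eq_top, Submodule.prod_top]

variable {k : Type w} {g : Type u} {M : Type v} [Field k]
  [AddCommGroup g] [Module k g] [LieSuperalgebra k g]
  [AddCommGroup M] [Module k M] [LieSuperalgebra k M] [SuperModule k g M]

/-- The projection to the odd component. -/
noncomputable def oddPart (k : Type w) (V : Type u) [Field k] [AddCommGroup V] [Module k V]
    [SuperSpace k V] : V →ₗ[k] V :=
  Submodule.projection (gr k V 1) (gr k V 0) SuperSpace.isCompl.symm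

lemma oddPart_of_odd {V : Type u} [AddCommGroup V] [Module k V] [SuperSpace k V] {x : V}
    (hx : x ∈ gr k V 1) : oddPart k V x = x := by
  simpa [oddPart] using hx

lemma oddPart_of_even {V : Type u} [AddCommGroup V] [Module k V] [SuperSpace k V] {x : V}
    (hx : x ∈ gr k V 0) : oddPart k V x = 0 := by
  simpa [oddPart] using hx

/-- The bracket `[(x, m), (y, n)] = ([x, y], x · n - (-1)^{|y||m|} y · m + f (x, y))` on `g × M`.
The sign is written without reference to degrees: `-(-1)^{|y||m|} y · m` is
`2 y₁ · m₁ - y · m`, with the odd components `y₁` and `m₁`. -/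
noncomputable def cocycleBracket (f : g →ₗ[k] g →ₗ[k] M) : g × M →ₗ[k] g × M →ₗ[k] g × M :=
  LinearMap.mk₂ k
    (fun a b => (br k a.1 b.1, op k a.1 b.2 +
      ((2 : k) • op k (oddPart k g b.1) (oddPart k M a.2) - op k b.1 a.2) + f a.1 b.1))
    (fun a a' b => by ext1 <;> simp [br, op, smul_add]; abel)
    (fun c a b => by ext1 <;> simp [br, op, smul_add, smul_sub, smul_comm c])
    (fun a b b' => by ext1 <;> simp [br, op, smul_add]; abel)
    (fun c a b => by ext1 <;> simp [br, op, smul_add, smul_sub, smul_comm c])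

lemma cocycleBracket_apply (f : g →ₗ[k] g →ₗ[k] M) (a b : g × M) :
    cocycleBracket f a b = (br k a.1 b.1, op k a.1 b.2 +
      ((2 : k) • op k (oddPart k g b.1) (oddPart k M a.2) - op k b.1 a.2) + f a.1 b.1) := rfl

lemma degree_eq_zero_or_one (i : ZMod 2) : i = 0 ∨ i = 1 := by
  revert i
  decide

lemma cocycleBracket_of_homogeneous (f : g →ₗ[k] g →ₗ[k] M) {i j : ZMod 2} {a b : g × M}
    (ha : a.2 ∈ gr k M i) (hb : b.1 ∈ gr k g j) :
    cocycleBracket f a b =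
      (br k a.1 b.1, op k a.1 b.2 - superSign i j • op k b.1 a.2 + f a.1 b.1) := by
  rw [cocycleBracket_apply]
  obtain rfl | rfl := degree_eq_zero_or_one i <;> obtain rfl | rfl := degree_eq_zero_or_one j
  · simp [oddPart_of_even ha, sub_eq_add_neg]
  · simp [oddPart_of_even ha, sub_eq_add_neg]
  · simp [oddPart_of_even hb, sub_eq_add_neg, op]
  · simp [oddPart_of_odd ha, oddPart_of_odd hb, two_smul]

lemma cocycleBracket_mem {f : g →ₗ[k] g →ₗ[k] M} (hf : f ∈ C2 k g M) {i j : ZMod 2} {a b : g × M}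
    (ha : a ∈ (gr k g i).prod (gr k M i)) (hb : b ∈ (gr k g j).prod (gr k M j)) :
    cocycleBracket f a b ∈ (gr k g (i + j)).prod (gr k M (i + j)) := by
  rw [cocycleBracket_of_homogeneous f ha.2 hb.1]
  refine ⟨LieSuperalgebra.bracket_mem ha.1 hb.1, Submodule.add_mem _ (Submodule.sub_mem _
    (SuperModule.act_mem ha.1 hb.2) (zsmul_mem ?_ _)) (hf i j _ ha.1 _ hb.1).1⟩
  rw [add_comm i j]
  exact SuperModule.act_mem hb.1 ha.2

lemma one_add_one_degree : (1 + 1 : ZMod 2) = 0 := rfl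

lemma cocycleBracket_skew {f : g →ₗ[k] g →ₗ[k] M} (hf : f ∈ C2 k g M) {i j : ZMod 2} {a b : g × M}
    (ha : a ∈ (gr k g i).prod (gr k M i)) (hb : b ∈ (gr k g j).prod (gr k M j)) :
    cocycleBracket f a b = -(superSign i j • cocycleBracket f b a) := by
  rw [cocycleBracket_of_homogeneous f ha.2 hb.1, cocycleBracket_of_homogeneous f hb.2 ha.1]
  ext1
  · exact LieSuperalgebra.bracket_skew ha.1 hb.1
  · simp only [Prod.snd_neg, Prod.smul_snd, (hf i j _ ha.1 _ hb.1).2]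
    obtain rfl | rfl := degree_eq_zero_or_one i <;> obtain rfl | rfl := degree_eq_zero_or_one j <;>
    · simp only [superSign_zero_left, superSign_zero_right, superSign_one_one, one_smul, neg_smul]
      abel

lemma cocycleBracket_jacobi {f : g →ₗ[k] g →ₗ[k] M} (hf : f ∈ Z2 k g M) {i j l : ZMod 2}
    {a b c : g × M} (ha : a ∈ (gr k g i).prod (gr k M i)) (hb : b ∈ (gr k g j).prod (gr k M j))
    (hc : c ∈ (gr k g l).prod (gr k M l)) :
    cocycleBracket f a (cocycleBracket f b c) = cocycleBracket f (cocycleBracket f a b) c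
      + superSign i j • cocycleBracket f b (cocycleBracket f a c) := by
  have hab := cocycleBracket_mem hf.1 ha hb
  have hac := cocycleBracket_mem hf.1 ha hc
  have hbc := cocycleBracket_mem hf.1 hb hc
  have hbr : ∀ {i j} {x y : g}, x ∈ gr k g i → y ∈ gr k g j → br k x y ∈ gr k g (i + j) :=
    fun hx hy => LieSuperalgebra.bracket_mem hx hy
  rw [cocycleBracket_of_homogeneous f ha.2 hbc.1, cocycleBracket_of_homogeneous f hab.2 hc.1,
    cocycleBracket_of_homogeneous f hb.2 hac.1, cocycleBracket_of_homogeneous f ha.2 hb.1,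
    cocycleBracket_of_homogeneous f ha.2 hc.1, cocycleBracket_of_homogeneous f hb.2 hc.1]
  ext1
  · exact LieSuperalgebra.bracket_jacobi ha.1 hb.1 hc.1
  · rw [← sub_eq_zero]
    refine Eq.trans ?_ (hf.2.1 i j l _ ha.1 _ hb.1 _ hc.1)
    simp only [Prod.snd_add, Prod.smul_snd, d2, (hf.1 i _ _ ha.1 _ (hbr hb.1 hc.1)).2,
      (hf.1 j _ _ hb.1 _ (hbr ha.1 hc.1)).2, SuperModule.act_bracket ha.1 hb.1,
      SuperModule.act_bracket ha.1 hc.1, SuperModule.act_bracket hb.1 hc.1]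
    obtain rfl | rfl := degree_eq_zero_or_one i <;> obtain rfl | rfl := degree_eq_zero_or_one j <;>
    obtain rfl | rfl := degree_eq_zero_or_one l <;>
    · simp only [superSign_zero_left, superSign_zero_right, superSign_one_one, one_smul, neg_smul,
        one_add_one_degree, add_zero, zero_add, map_add, map_sub, map_neg, op]
      abel

lemma cocycleBracket_cube {f : g →ₗ[k] g →ₗ[k] M} (hf : f ∈ Z2 k g M)
    {a : g × M} (ha : a ∈ (gr k g 1).prod (gr k M 1)) :
    cocycleBracket f a (cocycleBracket f a a) = 0 := by
  have haa := cocycleBracket_mem hf.1 ha ha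
  have hbr : br k a.1 a.1 ∈ gr k g (1 + 1) := LieSuperalgebra.bracket_mem ha.1 ha.1
  rw [cocycleBracket_of_homogeneous f ha.2 haa.1, cocycleBracket_of_homogeneous f ha.2 ha.1]
  ext1
  · exact LieSuperalgebra.bracket_cube ha.1
  · refine Eq.trans ?_ (hf.2.2 _ ha.1)
    simp only [(hf.1 1 _ _ ha.1 _ hbr).2, SuperModule.act_bracket ha.1 ha.1, one_add_one_degree,
      superSign_zero_right, superSign_one_one, one_smul, neg_smul, map_add, map_sub, map_neg, op]
    abel

/-- Every cocycle is the cocycle of a section of an extension. -/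
theorem exists_extension_of_mem_Z2 (hM : ∀ m n : M, br k m n = 0) {f : g →ₗ[k] g →ₗ[k] M}
    (hf : f ∈ Z2 k g M) : ∃ (E : Type (max u v)) (_ : AddCommGroup E) (_ : Module k E)
      (_ : LieSuperalgebra k E) (X : Extension k g M E) (s : g →ₗ[k] E), X.IsSection s f := by
  let _ : LieSuperalgebra k (g × M) :=
    { prodSuperSpace k g M with
      bracket := cocycleBracket f
      bracket_mem := cocycleBracket_mem hf.1
      bracket_skew := cocycleBracket_skew hf.1
      bracket_jacobi := cocycleBracket_jacobi hf
      bracket_cube := cocycleBracket_cube hf }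
  have hbr : ∀ a b : g × M, br k a b = cocycleBracket f a b := fun _ _ => rfl
  let X : Extension k g M (g × M) :=
    { incl := LinearMap.inr k g M
      proj := LinearMap.fst k g M
      incl_mem := fun hm => ⟨Submodule.zero_mem _, hm⟩
      proj_mem := fun he => he.1
      incl_bracket := fun m n => by
        rw [hbr, cocycleBracket_apply, hM]
        ext1 <;> simp [br, op]
      proj_bracket := fun _ _ => rfl
      incl_injective := LinearMap.inr_injective
      proj_surjective := LinearMap.fst_surjective
      exact := LinearMap.range_inr k g M
      bracket_incl := fun e m => by
        rw [hbr, cocycleBracket_apply]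
        ext1 <;> simp [br, op] }
  refine ⟨g × M, inferInstance, inferInstance, inferInstance, X, LinearMap.inl k g M,
    fun i x hx => ⟨hx, Submodule.zero_mem _⟩, fun x => rfl, fun x y => ?_⟩
  rw [hbr, cocycleBracket_apply]
  ext1 <;> simp [X, br, op]

end CocycleExtension

/-! ### The map from `H²` to semilinear maps -/

section Main

variable {k : Type w} {g : Type u} {M : Type v} [Field k]
  [AddCommGroup g] [Module k g] [LieSuperalgebra k g]
  [AddCommGroup M] [Module k M] [LieSuperalgebra k M] [SuperModule k g M]

lemma phiCochain_add_left (p : ℕ) [PMap k p g] (f f' : g →ₗ[k] g →ₗ[k] M) (x : gr k g 0) :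
    phiCochain p (f + f') x = phiCochain p f x + phiCochain p f' x := by
  ext y
  simp only [phiCochain, LinearMap.add_apply, LinearMap.sum_apply, LinearMap.comp_apply,
    LinearMap.flip_apply, map_add, Finset.sum_add_distrib]
  abel

lemma phiCochain_smul_left (p : ℕ) [PMap k p g] (c : k) (f : g →ₗ[k] g →ₗ[k] M) (x : gr k g 0) :
    phiCochain p (c • f) x = c • phiCochain p f x := by
  ext y
  simp [phiCochain, smul_add, Finset.smul_sum]

lemma phiCochain_zero_left (p : ℕ) [PMap k p g] (x : gr k g 0) :
    phiCochain p (0 : g →ₗ[k] g →ₗ[k] M) x = 0 := by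
  simpa using phiCochain_smul_left p (0 : k) (0 : g →ₗ[k] g →ₗ[k] M) x

/-- Adding the cochain `h` to a section with cocycle `0` gives a section whose cocycle is the
coboundary of `h`. -/
lemma exists_isSection_of_mem_B2 {f : g →ₗ[k] g →ₗ[k] M} (hf : f ∈ B2 k g M)
    {E : Type (max u v)} [AddCommGroup E] [Module k E] [LieSuperalgebra k E]
    {X : Extension k g M E} {s : g →ₗ[k] E} (hs : X.IsSection s 0)
    (hM : ∀ m n : M, br k m n = 0) : ∃ s', X.IsSection s' f := by
  obtain ⟨h, hh, hf⟩ := hf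
  refine ⟨s + X.incl ∘ₗ h, fun i x hx => Submodule.add_mem _ (hs.even i x hx)
    (X.incl_mem (hh i x hx)), fun x => ?_, fun x y => ?_⟩
  · simp [hs.proj_apply, X.proj_incl]
  · refine LinearMap.congr_fun (f := X.incl ∘ₗ f x)
      (g := LieSuperalgebra.bracket (k := k) (s x + X.incl (h x)) ∘ₗ (s + X.incl ∘ₗ h) -
        (s + X.incl ∘ₗ h) ∘ₗ adj k x) (linearMap_ext_homogeneous (k := k) fun j y hy => ?_) y
    refine LinearMap.congr_fun (f := X.incl ∘ₗ f.flip y)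
      (g := LieSuperalgebra.bracket (k := k).flip (s y + X.incl (h y)) ∘ₗ (s + X.incl ∘ₗ h) -
        (s + X.incl ∘ₗ h) ∘ₗ (LieSuperalgebra.bracket (k := k)).flip y)
      (linearMap_ext_homogeneous (k := k) fun i x hx => ?_) x
    have h0 := hs.cocycle x y
    have h1 := X.bracket_incl (s x) (h y)
    have h2 : br k (X.incl (h x)) (s y) = -(superSign i j • X.incl (op k y (h x))) := by
      have := X.bracket_incl (s y) (h x)
      rw [hs.proj_apply] at this
      rw [← this]
      exact LieSuperalgebra.bracket_skew (X.incl_mem (hh i x hx)) (hs.even j y hy)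
    have h3 := X.incl_bracket (h x) (h y)
    rw [hM, map_zero] at h3
    rw [hs.proj_apply] at h1
    simp only [LinearMap.zero_apply, map_zero] at h0
    have h4 := hf i j x hx y hy
    simp only [LinearMap.comp_apply, LinearMap.flip_apply, LinearMap.sub_apply,
      LinearMap.add_apply, map_add, h4, map_sub, map_zsmul]
    simp only [br] at h0 h1 h2 h3 ⊢
    rw [h1, h2, ← h3, add_zero, eq_add_of_sub_eq h0.symm, zero_add]
    abel

variable (p : ℕ) [hp : Fact p.Prime] [CharP k p] [PMap k p g]

lemma phiCochain_mem_Z1 (hM : ∀ m n : M, br k m n = 0) (hres : IsRestrictedModule k p g M)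
    {f : g →ₗ[k] g →ₗ[k] M} (hf : f ∈ Z2 k g M) (x : gr k g 0) : phiCochain p f x ∈ Z1 k g M := by
  obtain ⟨E, _, _, _, X, s, hs⟩ := exists_extension_of_mem_Z2 hM hf
  exact hs.phiCochain_mem_Z1 hres x

omit hp [CharP k p] in
lemma phiCochain_smul_right (hM : ∀ m n : M, br k m n = 0) {f : g →ₗ[k] g →ₗ[k] M}
    (hf : f ∈ Z2 k g M) (c : k) (x : gr k g 0) :
    phiCochain p f (c • x) = c ^ p • phiCochain p f x := by
  obtain ⟨E, _, _, _, X, s, hs⟩ := exists_extension_of_mem_Z2 hM hf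
  exact hs.phiCochain_smul c x

lemma phiCochain_add_right_sub_mem_B1 (hM : ∀ m n : M, br k m n = 0) {f : g →ₗ[k] g →ₗ[k] M}
    (hf : f ∈ Z2 k g M) (x y : gr k g 0) :
    phiCochain p f (x + y) - (phiCochain p f x + phiCochain p f y) ∈ B1 k g M := by
  obtain ⟨E, _, _, _, X, s, hs⟩ := exists_extension_of_mem_Z2 hM hf
  exact hs.phiCochain_add_sub_mem_B1 x y

/-- A coboundary is the cocycle of a section of the split extension, whose canonical section has
the cocycle `0`. -/
lemma phiCochain_mem_B1_of_mem_B2 (h2 : (2 : k) ≠ 0) (hM : ∀ m n : M, br k m n = 0)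
    (hres : IsRestrictedModule k p g M) {f : g →ₗ[k] g →ₗ[k] M} (hf : f ∈ B2 k g M)
    (x : gr k g 0) : phiCochain p f x ∈ B1 k g M := by
  obtain ⟨E, _, _, _, X, s, hs⟩ := exists_extension_of_mem_Z2 hM (Z2 k g M).zero_mem
  obtain ⟨s', hs'⟩ := exists_isSection_of_mem_B2 hf hs hM
  simpa [phiCochain_zero_left] using hs.phiCochain_sub_mem_B1 p hs' h2 hM hres x

/-- The map `f ↦ (x ↦ [Φ_{f,x}])` on cocycles. -/
noncomputable def phiZ2 (hM : ∀ m n : M, br k m n = 0) (hres : IsRestrictedModule k p g M) :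
    Z2 k g M →ₗ[k] (gr k g 0 →ₛₗ[frobenius k p] H1 k g M) where
  toFun f :=
    { toFun := fun x => H1.mk ⟨phiCochain p f.1 x, phiCochain_mem_Z1 p hM hres f.2 x⟩
      map_add' := fun x y => (Submodule.Quotient.eq _).2 <|
        phiCochain_add_right_sub_mem_B1 p hM f.2 x y
      map_smul' := fun c x => congrArg H1.mk <| Subtype.ext <|
        phiCochain_smul_right p hM f.2 c x }
  map_add' f f' := LinearMap.ext fun x => congrArg H1.mk <| Subtype.ext <|
    phiCochain_add_left p f.1 f'.1 x
  map_smul' c f := LinearMap.ext fun x => congrArg H1.mk <| Subtype.ext <|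
    phiCochain_smul_left p c f.1 x

lemma phiZ2_eq_zero_iff (hM : ∀ m n : M, br k m n = 0) (hres : IsRestrictedModule k p g M)
    (f : Z2 k g M) : phiZ2 p hM hres f = 0 ↔ ∀ x, phiCochain p f.1 x ∈ B1 k g M := by
  rw [LinearMap.ext_iff]
  exact forall_congr' fun x => Submodule.Quotient.mk_eq_zero _

end Main

end RestrictedSuper

theorem proposition4p4 {k : Type*} [Field k] (p : ℕ) [Fact p.Prime] [CharP k p] (hp : 2 < p)
    {g : Type*} [AddCommGroup g] [Module k g]
    [RestrictedSuper.LieSuperalgebra k g] [RestrictedSuper.PMap k p g]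
    {M : Type*} [AddCommGroup M] [Module k M]
    [RestrictedSuper.LieSuperalgebra k M] [RestrictedSuper.PMap k p M]
    (hM : RestrictedSuper.IsStronglyAbelian k p M)
    [RestrictedSuper.SuperModule k g M] (hres : RestrictedSuper.IsRestrictedModule k p g M) :
    ∃ Φ : RestrictedSuper.H2 k g M →ₗ[k]
        (RestrictedSuper.gr k g 0 →ₛₗ[frobenius k p] RestrictedSuper.H1 k g M),
      (∀ (f : RestrictedSuper.Z2 k g M) (x : RestrictedSuper.gr k g 0),
        ∃ hz : RestrictedSuper.phiCochain p f.1 x ∈ RestrictedSuper.Z1 k g M,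
          Φ (RestrictedSuper.H2.mk f) x = RestrictedSuper.H1.mk ⟨_, hz⟩) ∧
      RestrictedSuper.H20 k g M p = (LinearMap.ker Φ : Set (RestrictedSuper.H2 k g M)) := by
  have h2 : (2 : k) ≠ 0 := by
    have h : ((2 : ℕ) : k) ≠ 0 := by
      rw [Ne, CharP.cast_eq_zero_iff k p]
      exact fun h => absurd (Nat.le_of_dvd two_pos h) (by omega)
    exact_mod_cast h
  have hM' := hM.bracket_eq_zero
  refine ⟨Submodule.liftQ _ (RestrictedSuper.phiZ2 p hM' hres) fun f hf =>
    (RestrictedSuper.phiZ2_eq_zero_iff p hM' hres f).2 fun x =>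
      RestrictedSuper.phiCochain_mem_B1_of_mem_B2 p h2 hM' hres hf x, fun f x =>
    ⟨RestrictedSuper.phiCochain_mem_Z1 p hM' hres f.2 x, rfl⟩, ?_⟩
  ext c
  constructor
  · rintro ⟨E, _, _, _, _, X, hX, s, f, hs1, hs2, hs3, rfl⟩
    have hs : X.IsSection s f.1 := ⟨hs1, hs2, hs3⟩
    exact (RestrictedSuper.phiZ2_eq_zero_iff p hM' hres f).2 fun x =>
      hs.phiCochain_mem_B1_of_isRestricted hX x
  · intro hc
    obtain ⟨f, rfl⟩ := Submodule.Quotient.mk_surjective _ c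
    have hf := (RestrictedSuper.phiZ2_eq_zero_iff p hM' hres f).1 hc
    obtain ⟨E, _, _, _, X, s, hs⟩ := RestrictedSuper.exists_extension_of_mem_Z2 hM' f.2
    obtain ⟨P, hP⟩ := hs.exists_pmap_isRestricted p h2 hM hres hf
    exact ⟨E, _, _, _, P, X, hP, s, f, hs.even, hs.proj_apply, hs.cocycle, rfl⟩
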